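/- All CW-complexes are finite. Conventions. For a subcomplex $L\le K$, $K$ \emph{elementary collapses} to $L$ (and $L$ elementary expands to $K$) if $K=L\cup e^{m}\cup e^{m+1}$ with $e^m,e^{m+1}\notin L$ and $e^{m+1}$ has a characteristic map $\psi:D^{m}\times[-1,1]\to K$ whose restriction to $D^{m}\times\{1\}$ is a characteristic map of $e^{m}$ and which maps the rest $J=D^m\times\{-1\}\cup\partial D^m\times[-1,1]$ of the boundary into the $m$-skeleton of $L$. A retraction of the disk onto $J$ gives, through $\psi$, a strong deformation retraction $K\to L$ (unique up to homotopy rel $L$). $K\searrow L$ ($K$ collapses to $L$, $L$ expands to $K$) means a finite sequence of elementary collapses; the composite $K\to L$ of their retractions is the retraction of the collapse. A \emph{$k$-deformation} $f:K\to L$ is a finite composite of inclusions of elementary expansions and retractions of elementary collapses (and cellular isomorphisms) between complexes of dimension $\le k$. Let $K\searrow L$ with retraction $r_0$, and let $K\cup\bigcup_{i=1}^d e_i$ be obtained by attaching cells one after the other along $\varphi_i:\partial D_i\to K\cup\bigcup_{l<i}e_l$. An \emph{internal collapse} from $K\cup\bigcup_{i=1}^d e_i$ to $L\cup\bigcup_{i=1}^d\tilde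 e_i$, with $\dim\tilde e_i=\dim e_i$, consists of complexes $K=Z_0\le Z_1\le\dots\le Z_d$, with $\dim Z_i\le n+1$ for $i\ge1$, such that $$K\cup\bigcup_{l\le i}e_l\ \nearrow\ Z_i\ \searrow\ L\cup\bigcup_{l\le i}\tilde e_l ,$$ with inclusions $\iota_i$ of the left-hand complex and retractions $\tilde r_i$ onto the right-hand complex (where $\iota_0=\mathrm{id}$, $\tilde r_0=r_0$) which, like the inclusions of the right-hand complexes in $Z_i$, extend those for $i-1$; and $\tilde e_{i}$ is attached along $\tilde\varphi_i=\tilde r_{i-1}\,\iota_{i-1}\,\varphi_i$. Theorem. Let $L$ be a CW-complex of dimension at most $n$, and let $$L_0\le K_0\le L_1\le K_1\le\dots\le L_N\le K_N\le L_{N+1}=L$$ be subcomplexes with $K_j\searrow L_j$ and $L_{j+1}=K_j\cup\bigcup_{i=1}^{d_j}e_i^j$ for $0\le j\le N$, where retractions $K_j\to L_j$ of the collapses, an order in which the cells $e_i^j$ are attached successively, and their attaching maps are given. (The dimensions of the cells $e_i^j$ are arbitrary.) Then: (1) for every $j=0,\dots,N$ there is an internal collapse from $L_{j+1}$ to a complex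 $P_j=L_j\cup\bigcup_{i=1}^{d_j}\tilde e_i^j$; (2) any choice of such internal collapses, with maps $q_j=\tilde r\,\iota:L_{j+1}\to P_j$, induces an $(n+1)$-deformation $$f:L\longrightarrow M_{N+1}=L_0\cup\bigcup_{j=0}^{N}\bigcup_{i=1}^{d_j}\tilde e_i^j .$$ Precisely, there are $(n+1)$-deformations $g_j:L_j\to M_j=L_0\cup\bigcup_{j'<j}\bigcup_i\tilde e_i^{j'}$ with $M_0=L_0$, $g_0=\mathrm{id}$, $f=g_{N+1}$, where $M_{j+1}$ and $g_{j+1}$ are obtained as follows: the cells $\tilde e_1^j,\dots,\tilde e_{d_j}^j$ of $P_j$ are attached successively to $M_j$, by composing the attaching map of $\tilde e_i^j$ with an $(n+1)$-deformation $h_{i-1}:L_j\cup\bigcup_{l<i}\tilde e_l^j\to M_j\cup\bigcup_{l<i}\tilde e_l^j$, where $h_0=g_j$ and each $h_i$ extends $h_{i-1}$; and $g_{j+1}=h_{d_j}\circ q_j$. -/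

import Mathlib

universe u

/-- A finite CW-complex: a closed subspace `carrier` of a Hausdorff space `space`
with a finite CW structure (in the sense of Mathlib). -/
structure FiniteCW : Type (u + 1) where
  space : Type u
  [top : TopologicalSpace space]
  [t2 : T2Space space]
  carrier : Set space
  [cw : Topology.CWComplex carrier]
  [fin : Topology.RelCWComplex.Finite carrier]

namespace FiniteCW

attribute [instance] FiniteCW.top FiniteCW.t2 FiniteCW.cw FiniteCW.fin

/-- A finite CW-complex is used as a type through its points. -/
instance : CoeSort FiniteCW.{u} (Type u) := ⟨fun K => K.carrier⟩

/-- The `m`-cells of `K`. -/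
abbrev Cell (K : FiniteCW.{u}) (m : ℕ) : Type u := Topology.RelCWComplex.cell K.carrier m

/-- The open cell `c`, as a set of points of `K`. -/
def openCell (K : FiniteCW.{u}) {m : ℕ} (c : K.Cell m) : Set K :=
  {x | (x : K.space) ∈ Topology.RelCWComplex.openCell m c}

/-- The union of the cells of `K` of dimension `< m`, i.e. the `(m - 1)`-skeleton
(empty for `m = 0`). -/
def skeletonLT (K : FiniteCW.{u}) (m : ℕ) : Set K :=
  {x | (x : K.space) ∈ Topology.RelCWComplex.skeletonLT K.carrier (m : ℕ∞)}

/-- `dim K ≤ n`. -/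
def DimLE (K : FiniteCW.{u}) (n : ℕ) : Prop := ∀ m, n < m → IsEmpty (K.Cell m)

/-- A subcomplex of a finite CW-complex, as a finite CW-complex. -/
def ofSubcomplex (L : FiniteCW.{u}) (E : Topology.RelCWComplex.Subcomplex L.carrier) :
    FiniteCW.{u} where
  space := L.space
  carrier := (E : Set L.space)
  cw := Topology.CWComplex.Subcomplex.instCWComplex E
  fin := Topology.CWComplex.Subcomplex.finite_subcomplex_of_finite E

/-- The inclusion of a subcomplex in a larger subcomplex. -/
def inclSub (L : FiniteCW.{u}) {E F : Topology.RelCWComplex.Subcomplex L.carrier} (h : E ≤ F) :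
    C(L.ofSubcomplex E, L.ofSubcomplex F) :=
  ContinuousMap.inclusion (s := (E : Set L.space)) (t := (F : Set L.space)) h

/-- The inclusion of a subcomplex in the whole complex. -/
def inclTop (L : FiniteCW.{u}) (E : Topology.RelCWComplex.Subcomplex L.carrier) :
    C(L.ofSubcomplex E, L) :=
  ContinuousMap.inclusion (s := (E : Set L.space)) (t := L.carrier)
    (Topology.RelCWComplex.Subcomplex.subset_complex E)

end FiniteCW

namespace CWDeformation

/-- The `m`-disk `D^m`, in the model `[-1, 1]^m` that Mathlib uses for cells. -/
abbrev Disk (m : ℕ) : Type := Metric.closedBall (0 : Fin m → ℝ) 1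

/-- The boundary `∂D^m` of the `m`-disk. -/
abbrev DiskBoundary (m : ℕ) : Type := Metric.sphere (0 : Fin m → ℝ) 1

/-- The inclusion `∂D^m → D^m`. -/
def boundaryIncl (m : ℕ) : C(DiskBoundary m, Disk m) :=
  ContinuousMap.inclusion Metric.sphere_subset_closedBall

/-- The inclusion `x ↦ (x, 1)` of `D^m` as the top face of `D^(m+1) = D^m × [-1, 1]`. -/
def topFace (m : ℕ) : C(Disk m, Disk (m + 1)) where
  toFun x := ⟨Fin.snoc (α := fun _ => ℝ) x.1 1, by
    have hx := x.2
    rw [mem_closedBall_zero_iff] at hx ⊢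
    refine (pi_norm_le_iff_of_nonneg zero_le_one).2 fun k => ?_
    refine Fin.lastCases ?_ (fun k => ?_) k
    · simp
    · simpa using (norm_le_pi_norm x.1 k).trans hx⟩
  continuous_toFun := by
    refine Continuous.subtype_mk ?_ _
    exact Continuous.finSnoc (A := fun _ => ℝ) continuous_subtype_val continuous_const

/-- The rest of the boundary of `D^(m+1)`: the closure of `∂D^(m+1)` minus the top face, that is,
the bottom face together with the sides. -/
def openBox (m : ℕ) : Set (Disk (m + 1)) :=
  {x | x.1 (Fin.last m) = -1 ∨ ∃ k : Fin m, |x.1 k.castSucc| = 1}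

/-- `ψ : D^m → K` is a characteristic map of the `m`-cell `c`: it sends the interior of the disk
bijectively onto the open cell (hence homeomorphically, as `D^m` is compact and `K` is Hausdorff)
and the boundary of the disk into the `(m - 1)`-skeleton. -/
def IsCharacteristicMap (K : FiniteCW.{u}) {m : ℕ} (c : K.Cell m) (ψ : C(Disk m, K)) : Prop :=
  Set.BijOn ψ {x | ‖x.1‖ < 1} (K.openCell c) ∧ ∀ x : Disk m, ‖x.1‖ = 1 → ψ x ∈ K.skeletonLT m

/-- `i` identifies `L` with a subcomplex of `K`: it is injective (hence a closed embedding, as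
finite CW-complexes are compact Hausdorff) and sends every cell of `L` onto a cell of `K`. -/
def IsSubcomplexInclusion {L K : FiniteCW.{u}} (i : C(L, K)) : Prop :=
  Function.Injective i ∧
    ∀ (m : ℕ) (c : L.Cell m), ∃ c' : K.Cell m, i '' L.openCell c = K.openCell c'

/-- `j` and `r` are mutually inverse isomorphisms of CW-complexes. -/
def IsCellularIso {L K : FiniteCW.{u}} (j : C(L, K)) (r : C(K, L)) : Prop :=
  IsSubcomplexInclusion j ∧ IsSubcomplexInclusion r ∧
    r.comp j = ContinuousMap.id L ∧ j.comp r = ContinuousMap.id K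

/-- `K` elementary collapses to its subcomplex `L` (included by `j`): `K` consists of `L`, an
`m`-cell `c₀` and an `(m+1)`-cell `c₁`, and `c₁` has a characteristic map `ψ` whose restriction to
the top face is a characteristic map of `c₀` and which sends the rest of the boundary into the
`m`-skeleton of `L`. The map `r : K → L` is a strong deformation retraction induced by the
collapse: it is the identity on `L` and on `c₁` it is given, through `ψ`, by a retraction `ρ` of
the disk onto the rest of the boundary. (The disk is convex, so the choice of `ρ` does not matter
up to homotopy relative to `L`.) -/
def IsElementaryCollapse {L K : FiniteCW.{u}} (j : C(L, K)) (r : C(K, L)) : Prop :=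
  IsSubcomplexInclusion j ∧
  ∃ (m : ℕ) (c₀ : K.Cell m) (c₁ : K.Cell (m + 1)) (ψ : C(Disk (m + 1), K)),
    (Set.range j)ᶜ = K.openCell c₀ ∪ K.openCell c₁ ∧
    IsCharacteristicMap K c₁ ψ ∧
    IsCharacteristicMap K c₀ (ψ.comp (topFace m)) ∧
    (∀ x ∈ openBox m, ψ x ∈ j '' L.skeletonLT (m + 1)) ∧
    r.comp j = ContinuousMap.id L ∧
    ∃ ρ : C(Disk (m + 1), Disk (m + 1)),
      (∀ x, ρ x ∈ openBox m) ∧ (∀ x ∈ openBox m, ρ x = x) ∧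
      ∀ x, j (r (ψ x)) = ψ (ρ x)

/-- `K` collapses to its subcomplex `L` (included by `j`) through a finite sequence of elementary
collapses, and `r : K → L` is the composite of their retractions. -/
inductive IsCollapse : {L K : FiniteCW.{u}} → C(L, K) → C(K, L) → Prop
  | iso {L K : FiniteCW.{u}} {j : C(L, K)} {r : C(K, L)} (h : IsCellularIso j r) : IsCollapse j r
  | step {L K' K : FiniteCW.{u}} {j : C(K', K)} {r : C(K, K')} {j' : C(L, K')} {r' : C(K', L)}
      (h : IsElementaryCollapse j r) (h' : IsCollapse j' r') :
      IsCollapse (j.comp j') (r'.comp r)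

/-- `f : K → L` is (the map of) an `n`-deformation: a finite composite of inclusions given by
elementary expansions and retractions given by elementary collapses, through finite CW-complexes
of dimension at most `n`. -/
inductive IsDeformation (n : ℕ) : {K L : FiniteCW.{u}} → C(K, L) → Prop
  | iso {K L : FiniteCW.{u}} {f : C(K, L)} {g : C(L, K)} (h : IsCellularIso f g)
      (hdim : K.DimLE n) : IsDeformation n f
  | expand {K L : FiniteCW.{u}} {j : C(K, L)} {r : C(L, K)} (h : IsElementaryCollapse j r)
      (hdim : L.DimLE n) : IsDeformation n j
  | collapse {K L : FiniteCW.{u}} {j : C(L, K)} {r : C(K, L)} (h : IsElementaryCollapse j r)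
      (hdim : K.DimLE n) : IsDeformation n r
  | comp {K K' L : FiniteCW.{u}} {f : C(K, K')} {g : C(K', L)} (hf : IsDeformation n f)
      (hg : IsDeformation n g) : IsDeformation n (g.comp f)

/-- `A' = A ∪_φ D^m`, with inclusion `a : A → A'`: `A'` is obtained from `A` by attaching one
`m`-cell along `φ : ∂D^m → A`. -/
def IsCellAttachment {A A' : FiniteCW.{u}} {m : ℕ} (φ : C(DiskBoundary m, A)) (a : C(A, A')) :
    Prop :=
  IsSubcomplexInclusion a ∧
  ∃ (c : A'.Cell m) (ψ : C(Disk m, A')),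
    (Set.range a)ᶜ = A'.openCell c ∧ IsCharacteristicMap A' c ψ ∧
    ψ.comp (boundaryIncl m) = a.comp φ

/-- A way of writing `A = K ∪ e_1 ∪ ⋯ ∪ e_d`: finitely many cells, attached one after the other,
together with their attaching maps. The dimensions of the cells are arbitrary. -/
inductive CellTower (K : FiniteCW.{u}) : FiniteCW.{u} → Type (u + 1)
  | nil : CellTower K K
  | attach {A A' : FiniteCW.{u}} (T : CellTower K A) {m : ℕ} (φ : C(DiskBoundary m, A))
      (a : C(A, A')) (h : IsCellAttachment φ a) : CellTower K A'

/-- The inclusion of `K` in `K ∪ e_1 ∪ ⋯ ∪ e_d`. -/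
def CellTower.incl {K : FiniteCW.{u}} : {A : FiniteCW.{u}} → CellTower K A → C(K, A)
  | _, .nil => ContinuousMap.id K
  | _, .attach T _ a _ => a.comp T.incl

/-- `IsInternalCollapse n j₀ r₀ T U ι j r`: given a collapse `K ↘ L` with inclusion `j₀` and
retraction `r₀`, and cells `T` attached to `K`, this is an internal collapse from
`A = K ∪ e_1 ∪ ⋯ ∪ e_d` (the tower `T`) to `B = L ∪ ẽ_1 ∪ ⋯ ∪ ẽ_d` (the tower `U`).
For each `d` there is a complex `Z_d`, with `Z_0 = K ≤ Z_1 ≤ Z_2 ≤ ⋯` and `dim Z_d ≤ n + 1`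
for `d ≥ 1`, that expands from `A` (inclusion `ι`) and collapses to `B` (inclusion `j`,
retraction `r`); the cell `e_{d+1}` is attached along `φ`, and `ẽ_{d+1}` along `r ∘ ι ∘ φ`. The
inclusions and retractions for `d + 1` extend those for `d`. -/
inductive IsInternalCollapse (n : ℕ) {K L : FiniteCW.{u}} (j₀ : C(L, K)) (r₀ : C(K, L)) :
    {A Z B : FiniteCW.{u}} → CellTower K A → CellTower L B →
      C(A, Z) → C(B, Z) → C(Z, B) → Prop
  | base (h : IsCollapse j₀ r₀) :
      IsInternalCollapse n j₀ r₀ .nil .nil (ContinuousMap.id K) j₀ r₀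
  | attach {A Z B A' Z' B' : FiniteCW.{u}} {T : CellTower K A} {U : CellTower L B}
      {ι : C(A, Z)} {j : C(B, Z)} {r : C(Z, B)}
      (h : IsInternalCollapse n j₀ r₀ T U ι j r)
      {m : ℕ} {φ : C(DiskBoundary m, A)} {a : C(A, A')} (ha : IsCellAttachment φ a)
      {b : C(B, B')} (hb : IsCellAttachment (r.comp (ι.comp φ)) b)
      {z : C(Z, Z')} (hz : IsSubcomplexInclusion z) (hdim : Z'.DimLE (n + 1))
      {ι' : C(A', Z')} {s' : C(Z', A')} (hι : IsCollapse ι' s')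
      {j' : C(B', Z')} {r' : C(Z', B')} (hr : IsCollapse j' r')
      (hιz : ι'.comp a = z.comp ι) (hjz : j'.comp b = z.comp j) (hrz : r'.comp z = b.comp r) :
      IsInternalCollapse n j₀ r₀ (T.attach φ a ha) (U.attach (r.comp (ι.comp φ)) b hb) ι' j' r'

/-- `IsInducedAttachment k W g U V f`: let `g : A → M` be a `k`-deformation, let
`B = A ∪ e_1 ∪ ⋯ ∪ e_d` be given by the tower `U`, and let `M` be given by the tower `W`. Then the
tower `V`, giving `M' = M ∪ ẽ_1 ∪ ⋯ ∪ ẽ_d`, extends `W` by cells whose attaching maps are induced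
by those of `U`: if `e_{d+1}` is attached along `φ`, then `ẽ_{d+1}` is attached along `f ∘ φ`,
where `f` is a `k`-deformation from `A ∪ e_1 ∪ ⋯ ∪ e_d` to `M ∪ ẽ_1 ∪ ⋯ ∪ ẽ_d` that extends the
previous ones. -/
inductive IsInducedAttachment (k : ℕ) {A M₀ M : FiniteCW.{u}} (W : CellTower M₀ M) (g : C(A, M)) :
    {B M' : FiniteCW.{u}} → CellTower A B → CellTower M₀ M' → C(B, M') → Prop
  | base (hg : IsDeformation k g) : IsInducedAttachment k W g .nil W g
  | attach {B M' B' M'' : FiniteCW.{u}} {U : CellTower A B} {V : CellTower M₀ M'} {f : C(B, M')}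
      (h : IsInducedAttachment k W g U V f)
      {m : ℕ} {φ : C(DiskBoundary m, B)} {b : C(B, B')} (hb : IsCellAttachment φ b)
      {c : C(M', M'')} (hc : IsCellAttachment (f.comp φ) c)
      {f' : C(B', M'')} (hf : IsDeformation k f') (hext : f'.comp b = c.comp f) :
      IsInducedAttachment k W g (U.attach φ b hb) (V.attach (f.comp φ) c hc) f'

/-- Composition of internal collapses. Let `q j : L_{j+1} → P_j = L_j ∪ ⋃_i ẽ_i^j` be the
deformations given by internal collapses, for `j = 0, …, N`. Then `IsInducedReduction k U q j W g`
says that `W` presents a complex `M_j = L_0 ∪ ⋃_{j' < j} ⋃_i ẽ_i^{j'}`, with a map `g : L_j → M_j`,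
that is built recursively: `M_0 = L_0`, the cells `ẽ_i^j` of `P_j` are attached to `M_j` along the
maps induced by `g : L_j → M_j`, which gives `M_{j+1}` and an extension `f : P_j → M_{j+1}` of `g`,
and the next map is `f ∘ q j : L_{j+1} → P_j → M_{j+1}`. -/
inductive IsInducedReduction (k : ℕ) {N : ℕ} {L : Fin (N + 2) → FiniteCW.{u}}
    {P : Fin (N + 1) → FiniteCW.{u}} (U : ∀ j : Fin (N + 1), CellTower (L j.castSucc) (P j))
    (q : ∀ j : Fin (N + 1), C(L j.succ, P j)) :
    (j : Fin (N + 2)) → {M : FiniteCW.{u}} → CellTower (L 0) M → C(L j, M) → Prop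
  | start : IsInducedReduction k U q 0 .nil (ContinuousMap.id (L 0))
  | step (j : Fin (N + 1)) {M M' : FiniteCW.{u}} {W : CellTower (L 0) M} {g : C(L j.castSucc, M)}
      (h : IsInducedReduction k U q j.castSucc W g)
      {V : CellTower (L 0) M'} {f : C(P j, M')} (hf : IsInducedAttachment k W g (U j) V f) :
      IsInducedReduction k U q j.succ V (f.comp (q j))

end CWDeformation

open CWDeformation

/-!
Two constructions carry the proof.

*Sliding.* If the attaching maps `φ₀`, `φ₁` of two `m`-cells are homotopic in the `m`-skeleton of
`A`, then `A ∪ e₀` and `A ∪ e₁` have a common elementary expansion, in which an `(m+1)`-cell fills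
the cylinder `D^m × [-1, 1]` between `e₀` and `e₁` (`exists_common_elementary_expansion`). The
homotopies needed come from collapses: the retraction of an elementary collapse is homotopic to the
identity through the upper cell, and this raises the dimension of skeleta by at most one
(`IsCollapse.homotopicInSkeleton`).

*Pushing forward.* If `K` collapses to `L` and the same cell is attached to `L` and, through the
inclusion, to `K`, then `K ∪ e` collapses to `L ∪ e` by an extension of the retraction
(`IsCollapse.attach`).

For the first part, let `A ↗ Z ↘ B` be given, with maps `ι`, `j`, `r`, and let a cell be attached to
`A` along `φ`. Pushing forward turns `A ↗ Z` into `A ∪ e ↗ Z ∪ e` and `Z ↘ B` into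
`Z ∪ ẽ ↘ B ∪ ẽ`, where `ẽ` is attached along `r ι φ`, and sliding from `ι φ` to `j r ι φ` connects
`Z ∪ e` with `Z ∪ ẽ` (`exists_internalCollapse_step`).

For the second part it suffices that a deformation `g : A → M` extends over a cell that is attached
to `A` along `φ` and to `M` along `g φ` (`IsDeformation.exists_extension`). This is pushing forward
if `g` is an expansion, and sliding from `φ` to `j r φ` followed by pushing forward if `g = r` is
the retraction of an elementary collapse with inclusion `j`. The cells have dimension at most `n`,
so the sliding takes place in dimension at most `n + 1`.

Mathlib has no cell attachments for its CW complexes, so these are constructed first: the adjunction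
space is realised as a subspace of a product of lines (`exists_adjunctionSpace`), and its cells are
given by characteristic maps (`exists_finiteCW_of_characteristicMaps`).
-/

/-! ### Cells and skeleta of finite complexes -/

namespace FiniteCW

open Topology

/-- A finite complex is compact, being a finite union of closed cells. -/
instance (K : FiniteCW.{u}) : CompactSpace K := by
  have hfin : Finite (Σ n, K.Cell n) := RelCWComplex.finite_cells_of_finite
  refine isCompact_iff_compactSpace.1 ?_
  have h : (⋃ p : Σ n, K.Cell n, RelCWComplex.closedCell p.1 p.2) = K.carrier :=
    (Set.iUnion_sigma _).trans (CWComplex.union (C := K.carrier))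
  rw [← h]
  exact isCompact_iUnion fun p => RelCWComplex.isCompact_closedCell

lemma exists_mem_openCell {K : FiniteCW.{u}} (x : K) :
    ∃ (m : ℕ) (c : K.Cell m), x ∈ K.openCell c := by
  have hx : (x : K.space) ∈ ⋃ (n : ℕ) (j : K.Cell n), RelCWComplex.openCell n j := by
    rw [CWComplex.iUnion_openCell_eq_complex]
    exact x.2
  obtain ⟨m, hm⟩ := Set.mem_iUnion.1 hx
  obtain ⟨c, hc⟩ := Set.mem_iUnion.1 hm
  exact ⟨m, c, hc⟩

lemma cell_eq_of_mem {K : FiniteCW.{u}} {m k : ℕ} {c : K.Cell m} {d : K.Cell k} {x : K}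
    (hc : x ∈ K.openCell c) (hd : x ∈ K.openCell d) : (⟨m, c⟩ : Σ n, K.Cell n) = ⟨k, d⟩ :=
  RelCWComplex.eq_of_not_disjoint_openCell fun h => Set.disjoint_left.1 h hc hd

lemma dim_eq_of_mem {K : FiniteCW.{u}} {m k : ℕ} {c : K.Cell m} {d : K.Cell k} {x : K}
    (hc : x ∈ K.openCell c) (hd : x ∈ K.openCell d) : m = k :=
  congrArg Sigma.fst (cell_eq_of_mem hc hd)

lemma openCell_nonempty (K : FiniteCW.{u}) {m : ℕ} (c : K.Cell m) : (K.openCell c).Nonempty := by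
  obtain ⟨x, hx⟩ := RelCWComplex.openCell_nonempty (C := K.carrier) m c
  exact ⟨⟨x, RelCWComplex.openCell_subset_complex m c hx⟩, hx⟩

lemma mem_skeletonLT {K : FiniteCW.{u}} {m : ℕ} {x : K} :
    x ∈ K.skeletonLT m ↔ ∃ k < m, ∃ c : K.Cell k, x ∈ K.openCell c := by
  refine (CWComplex.mem_skeletonLT_iff (C := K.carrier)).trans ?_
  simp [openCell]

lemma skeletonLT_mono (K : FiniteCW.{u}) {m k : ℕ} (h : m ≤ k) :
    K.skeletonLT m ⊆ K.skeletonLT k := fun _ hx => by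
  obtain ⟨l, hl, hc⟩ := mem_skeletonLT.1 hx
  exact mem_skeletonLT.2 ⟨l, hl.trans_le h, hc⟩

lemma DimLE.mono {K : FiniteCW.{u}} {m k : ℕ} (hK : K.DimLE m) (h : m ≤ k) : K.DimLE k :=
  fun l hl => hK l (h.trans_lt hl)

end FiniteCW

namespace CWDeformation

open Topology

lemma Disk.norm_le {m : ℕ} (x : Disk m) : ‖x.1‖ ≤ 1 := mem_closedBall_zero_iff.1 x.2

lemma Disk.norm_lt_or_eq {m : ℕ} (x : Disk m) : ‖x.1‖ < 1 ∨ ‖x.1‖ = 1 := (Disk.norm_le x).lt_or_eq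

lemma exists_isCharacteristicMap (K : FiniteCW.{u}) {m : ℕ} (c : K.Cell m) :
    ∃ ψ : C(Disk m, K), IsCharacteristicMap K c ψ := by
  have hmem : ∀ x : Disk m, RelCWComplex.map m c x.1 ∈ K.carrier := fun x =>
    RelCWComplex.closedCell_subset_complex m c ⟨x.1, x.2, rfl⟩
  refine ⟨⟨fun x => ⟨RelCWComplex.map m c x.1, hmem x⟩, Continuous.subtype_mk
    (continuousOn_iff_continuous_domRestrict.1 (RelCWComplex.continuousOn m c)) _⟩,
    ⟨?_, ?_, ?_⟩, ?_⟩
  · intro x hx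
    exact ⟨x.1, mem_ball_zero_iff.2 hx, rfl⟩
  · intro x hx y hy h
    have hinj := (RelCWComplex.map m c).injOn
    rw [RelCWComplex.source_eq] at hinj
    exact Subtype.ext (hinj (mem_ball_zero_iff.2 hx) (mem_ball_zero_iff.2 hy)
      (congrArg Subtype.val h))
  · rintro ⟨y, hy⟩ ⟨x, hx, rfl⟩
    exact ⟨⟨x, Metric.ball_subset_closedBall hx⟩, mem_ball_zero_iff.1 hx, rfl⟩
  · intro x hx
    exact RelCWComplex.cellFrontier_subset_skeletonLT (C := K.carrier) m c
      ⟨x.1, mem_sphere_zero_iff_norm.2 hx, rfl⟩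

/-- A Hausdorff space with finitely many prospective cells `χ c : D^m → Q`, whose interiors embed
and partition `Q` and whose boundaries lie in cells of lower dimension, is a finite complex with
these characteristic maps. Compactness of the disks supplies the topological conditions. -/
lemma exists_finiteCW_of_characteristicMaps {Q : Type u} [TopologicalSpace Q] [T2Space Q]
    (cell : ℕ → Type u) [Finite (Σ m, cell m)] (χ : ∀ m, cell m → C(Disk m, Q))
    (hinj : ∀ m (c : cell m), Set.InjOn (χ m c) {x | ‖x.1‖ < 1})
    (hdisj : ∀ m (c : cell m) k (d : cell k) (x : Disk m) (y : Disk k), ‖x.1‖ < 1 → ‖y.1‖ < 1 →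
      χ m c x = χ k d y → (⟨m, c⟩ : Σ m, cell m) = ⟨k, d⟩)
    (hbdry : ∀ m (c : cell m) (x : Disk m), ‖x.1‖ = 1 →
      ∃ k < m, ∃ (d : cell k) (y : Disk k), ‖y.1‖ < 1 ∧ χ k d y = χ m c x)
    (hcover : ∀ q, ∃ m, ∃ (c : cell m) (x : Disk m), ‖x.1‖ < 1 ∧ χ m c x = q) :
    ∃ (K : FiniteCW.{u}) (e : Q ≃ₜ K) (σ : ∀ m, cell m ≃ K.Cell m),
      ∀ m (c : cell m), IsCharacteristicMap K (σ m c) ((e : C(Q, K)).comp (χ m c)) := by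
  classical
  have hball : ∀ {m : ℕ} (x : Fin m → ℝ), x ∈ Metric.ball (0 : Fin m → ℝ) 1 → ‖x‖ < 1 :=
    fun x hx => mem_ball_zero_iff.1 hx
  have hcl : ∀ {m : ℕ} (x : Fin m → ℝ), x ∈ Metric.ball (0 : Fin m → ℝ) 1 →
      x ∈ Metric.closedBall (0 : Fin m → ℝ) 1 := fun x hx => Metric.ball_subset_closedBall hx
  let F : ∀ m, cell m → (Fin m → ℝ) → Q := fun m c x =>
    if h : x ∈ Metric.closedBall (0 : Fin m → ℝ) 1 then χ m c ⟨x, h⟩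
    else χ m c ⟨0, Metric.mem_closedBall_self zero_le_one⟩
  have hF : ∀ m (c : cell m) (x : Disk m), F m c x.1 = χ m c x := fun m c x => dif_pos x.2
  have hFinj : ∀ m (c : cell m), Set.InjOn (F m c) (Metric.ball 0 1) := by
    intro m c x hx y hy h
    rw [hF m c ⟨x, hcl x hx⟩, hF m c ⟨y, hcl y hy⟩] at h
    exact congrArg Subtype.val (hinj m c (hball x hx) (hball y hy) h)
  have hFball : ∀ m (c : cell m) q, q ∈ F m c '' Metric.ball 0 1 ↔
      ∃ x : Disk m, ‖x.1‖ < 1 ∧ χ m c x = q := by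
    intro m c q
    constructor
    · rintro ⟨x, hx, rfl⟩
      exact ⟨⟨x, hcl x hx⟩, hball x hx, (hF m c ⟨x, hcl x hx⟩).symm⟩
    · rintro ⟨x, hx, rfl⟩
      exact ⟨x.1, mem_ball_zero_iff.2 hx, hF m c x⟩
  let P : ∀ m, cell m → PartialEquiv (Fin m → ℝ) Q := fun m c =>
    (hFinj m c).toPartialEquiv (F m c) (Metric.ball 0 1)
  have hPF : ∀ m c x, P m c x = F m c x := fun m c x => rfl
  have hcont : ∀ m (c : cell m), ContinuousOn (P m c) (Metric.closedBall 0 1) := by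
    intro m c
    refine continuousOn_iff_continuous_domRestrict.2 ?_
    exact (χ m c).continuous.congr fun x => (hF m c x).symm
  have hsymm : ∀ m (c : cell m), ContinuousOn (P m c).symm (P m c).target := by
    intro m c
    refine continuousOn_iff_isClosed.2 fun t ht => ⟨χ m c '' {x | x.1 ∈ t}, ?_, ?_⟩
    · exact ((ht.preimage continuous_subtype_val).isCompact.image (χ m c).continuous).isClosed
    · ext q
      refine and_congr_left fun hq => ?_
      obtain ⟨x, hx, rfl⟩ := hq
      have hx' : (P m c).symm (F m c x) = x := (P m c).left_inv hx
      rw [Set.mem_preimage, hx']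
      constructor
      · intro hxt
        exact ⟨⟨x, hcl x hx⟩, hxt, (hF m c ⟨x, hcl x hx⟩).symm⟩
      · rintro ⟨y, hyt, hy⟩
        rw [hF m c ⟨x, hcl x hx⟩] at hy
        rcases Disk.norm_lt_or_eq y with h | h
        · have := hinj m c h (hball x hx) hy
          rwa [this] at hyt
        · -- The boundary misses the open cell, so the inverse is a closed map on the whole disk.
          obtain ⟨k, hk, d, z, hz, hzy⟩ := hbdry m c y h
          have := hdisj k d m c z ⟨x, hcl x hx⟩ hz (hball x hx) (hzy.trans hy)
          exact absurd (congrArg Sigma.fst this) hk.ne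
  have hdis : (Set.univ : Set (Σ m, cell m)).PairwiseDisjoint
      (fun p => P p.1 p.2 '' Metric.ball 0 1) := by
    rintro ⟨m, c⟩ - ⟨k, d⟩ - hne
    refine Set.disjoint_left.2 fun q hq hq' => hne ?_
    obtain ⟨x, hx, rfl⟩ := (hFball m c q).1 hq
    obtain ⟨y, hy, hxy⟩ := (hFball k d _).1 hq'
    exact hdisj m c k d x y hx hy hxy.symm
  have hmaps : ∀ m (c : cell m), Set.MapsTo (P m c) (Metric.sphere 0 1)
      (⋃ (k < m) (d : cell k), P k d '' Metric.closedBall 0 1) := by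
    intro m c x hx
    obtain ⟨k, hk, d, y, hy, h⟩ := hbdry m c ⟨x, Metric.sphere_subset_closedBall hx⟩
      (mem_sphere_zero_iff_norm.1 hx)
    simp only [Set.mem_iUnion]
    refine ⟨k, hk, d, y.1, y.2, ?_⟩
    rw [hPF, hPF, hF, h, hF m c ⟨x, Metric.sphere_subset_closedBall hx⟩]
  have hunion : ⋃ (m : ℕ) (c : cell m), P m c '' Metric.closedBall 0 1 = Set.univ := by
    refine Set.eq_univ_of_forall fun q => ?_
    obtain ⟨m, c, x, -, rfl⟩ := hcover q
    simp only [Set.mem_iUnion]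
    exact ⟨m, c, x.1, x.2, hF m c x⟩
  let cw : CWComplex (Set.univ : Set Q) :=
    { cell := cell, map := P, source_eq := fun _ _ => rfl, continuousOn := hcont
      continuousOn_symm := hsymm, pairwiseDisjoint' := hdis
      mapsTo' := fun m c => by
        have hfin : ∀ k, Finite (cell k) := fun k => Finite.of_injective (Sigma.mk k)
          sigma_mk_injective
        refine ⟨fun k => (Set.toFinite (Set.univ : Set (cell k))).toFinset, ?_⟩
        simpa using hmaps m c
      closed' := fun A _ hA => by
        have h : A = ⋃ p : Σ m, cell m, A ∩ P p.1 p.2 '' Metric.closedBall 0 1 := by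
          rw [← Set.inter_iUnion, Set.iUnion_sigma, hunion, Set.inter_univ]
        rw [h]
        exact isClosed_iUnion_of_finite fun p => hA p.1 p.2
      union' := hunion }
  have hfin : RelCWComplex.Finite (Set.univ : Set Q) :=
    RelCWComplex.finite_of_finite_cells (C := (Set.univ : Set Q)) (D := ∅)
      (show Finite (Σ m, cell m) from inferInstance)
  let K : FiniteCW.{u} := { space := Q, carrier := Set.univ, cw := cw, fin := hfin }
  let e : Q ≃ₜ K := (Homeomorph.Set.univ Q).symm
  have hopen : ∀ m (c : cell m) (q : Q), e q ∈ K.openCell (m := m) c ↔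
      ∃ x : Disk m, ‖x.1‖ < 1 ∧ χ m c x = q := hFball
  refine ⟨K, e, fun m => Equiv.refl _, fun m c => ⟨⟨?_, ?_, ?_⟩, ?_⟩⟩
  · intro x hx
    exact (hopen m c _).2 ⟨x, hx, rfl⟩
  · intro x hx y hy h
    exact hinj m c hx hy (e.injective h)
  · intro q hq
    obtain ⟨q, rfl⟩ := e.surjective q
    obtain ⟨x, hx, rfl⟩ := (hopen m c q).1 hq
    exact ⟨x, hx, rfl⟩
  · intro x hx
    obtain ⟨k, hk, d, y, hy, h⟩ := hbdry m c x hx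
    exact FiniteCW.mem_skeletonLT.2 ⟨k, hk, d, (hopen k d _).2 ⟨y, hy, h⟩⟩

/-! ### Attaching a cell -/

/-- The adjunction space `A ∪_φ D^m` exists as a Hausdorff space: `A` and the open disk are disjoint
subsets that cover it, and the boundary of the disk is glued to `A` along `φ`. -/
lemma exists_adjunctionSpace (A : Type u) [TopologicalSpace A] [CompactSpace A] [T2Space A] {m : ℕ}
    (φ : C(DiskBoundary m, A)) :
    ∃ (Q : Type u) (_ : TopologicalSpace Q) (_ : T2Space Q) (i : C(A, Q)) (k : C(Disk m, Q)),
      Function.Injective i ∧ Set.InjOn k {x | ‖x.1‖ < 1} ∧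
      (∀ a x, ‖x.1‖ < 1 → i a ≠ k x) ∧ k.comp (boundaryIncl m) = i.comp φ ∧
      ∀ q, (∃ a, i a = q) ∨ ∃ x, ‖x.1‖ < 1 ∧ k x = q := by
  -- The two spaces are mapped compatibly to a product of lines: real functions on `A` are extended
  -- over the disk, and the coordinates scaled by `1 - ‖x‖` separate the interior points.
  have hemb : IsClosedEmbedding (boundaryIncl m) :=
    (boundaryIncl m).continuous.isClosedEmbedding
      (Set.inclusion_injective Metric.sphere_subset_closedBall)
  have hext : ∀ f : C(A, ℝ), ∃ g : C(Disk m, ℝ), ∀ x, g (boundaryIncl m x) = f (φ x) := by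
    intro f
    obtain ⟨g, hg⟩ := ContinuousMap.exists_extension' hemb (f.comp φ)
    exact ⟨g, fun x => congrFun hg x⟩
  choose E hE using hext
  let I : A → (C(A, ℝ) → ℝ) × (Fin m → ℝ) × ℝ := fun a => (fun f => f a, 0, 0)
  let J : Disk m → (C(A, ℝ) → ℝ) × (Fin m → ℝ) × ℝ := fun x =>
    (fun f => E f x, (1 - ‖x.1‖) • x.1, 1 - ‖x.1‖)
  have hI : Continuous I := by fun_prop
  have hJ : Continuous J := by fun_prop
  have hIinj : Function.Injective I := by
    intro a b h
    by_contra hne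
    obtain ⟨f, hf⟩ := exists_continuous_zero_one_of_isClosed (isClosed_singleton (x := a))
      (isClosed_singleton (x := b)) (by simpa using hne)
    have h1 := congrFun (congrArg Prod.fst h) f
    have h2 : f a = 0 := hf.1 rfl
    have h3 : f b = 1 := hf.2.1 rfl
    simp [I, h2, h3] at h1
  have hJI : ∀ x : DiskBoundary m, J (boundaryIncl m x) = I (φ x) := by
    intro x
    have hx : ‖(boundaryIncl m x).1‖ = 1 := mem_sphere_zero_iff_norm.1 x.2
    ext1
    · funext f
      exact hE f x
    · simp [I, J, hx]
  refine ⟨↥(Set.range I ∪ Set.range J), inferInstance, inferInstance,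
    ⟨fun a => ⟨I a, Or.inl ⟨a, rfl⟩⟩, by fun_prop⟩, ⟨fun x => ⟨J x, Or.inr ⟨x, rfl⟩⟩, by fun_prop⟩,
    ?_, ?_, ?_, ?_, ?_⟩
  · intro a b h
    exact hIinj (congrArg Subtype.val h)
  · intro x hx y hy h
    have h' : J x = J y := congrArg Subtype.val h
    have h1 : 1 - ‖x.1‖ = 1 - ‖y.1‖ := congrArg (fun p => p.2.2) h'
    have h2 : (1 - ‖x.1‖) • x.1 = (1 - ‖y.1‖) • y.1 := congrArg (fun p => p.2.1) h'
    rw [← h1] at h2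
    have hx' : ‖x.1‖ < 1 := hx
    exact Subtype.ext (smul_right_injective _ (sub_pos.2 hx').ne' h2)
  · intro a x hx h
    have h' : I a = J x := congrArg Subtype.val h
    have h1 : (0 : ℝ) = 1 - ‖x.1‖ := congrArg (fun p => p.2.2) h'
    linarith
  · ext x : 1
    exact Subtype.ext (hJI x)
  · rintro ⟨q, ⟨a, rfl⟩ | ⟨x, rfl⟩⟩
    · exact Or.inl ⟨a, rfl⟩
    · rcases Disk.norm_lt_or_eq x with h | h
      · exact Or.inr ⟨x, h, rfl⟩
      · refine Or.inl ⟨φ ⟨x.1, mem_sphere_zero_iff_norm.2 h⟩, Subtype.ext ?_⟩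
        exact (hJI _).symm

/-- A cell can be attached along any map of its boundary to the skeleton below it. -/
theorem exists_isCellAttachment {A : FiniteCW.{u}} {m : ℕ} (φ : C(DiskBoundary m, A))
    (hφ : ∀ x, φ x ∈ A.skeletonLT m) :
    ∃ (A' : FiniteCW.{u}) (a : C(A, A')), IsCellAttachment φ a := by
  obtain ⟨Q, _, _, i, k, hi, hk, hik, hkφ, hQ⟩ := exists_adjunctionSpace A φ
  have hfinA : Finite (Σ n, A.Cell n) := RelCWComplex.finite_cells_of_finite
  choose χA hχA using fun m (c : A.Cell m) => exists_isCharacteristicMap A c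
  let cell : ℕ → Type u := fun l => A.Cell l ⊕ ULift.{u} (PLift (m = l))
  have hfin : Finite (Σ l, cell l) := by
    let F : (Σ n, A.Cell n) ⊕ Unit → Σ l, cell l :=
      Sum.elim (fun p => ⟨p.1, Sum.inl p.2⟩) (fun _ => ⟨m, Sum.inr ⟨⟨rfl⟩⟩⟩)
    refine Finite.of_surjective F ?_
    rintro ⟨l, c | ⟨⟨⟨rfl⟩⟩⟩⟩
    · exact ⟨Sum.inl ⟨l, c⟩, rfl⟩
    · exact ⟨Sum.inr (), rfl⟩
  let χ : ∀ l, cell l → C(Disk l, Q) := fun l =>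
    Sum.elim (fun c => i.comp (χA l c)) (fun h => h.down.down ▸ k)
  have hold : ∀ {a : A} {l : ℕ} {c : A.Cell l}, a ∈ A.openCell c →
      ∃ x : Disk l, ‖x.1‖ < 1 ∧ χ l (Sum.inl c) x = i a := by
    intro a l c ha
    obtain ⟨x, hx, hxa⟩ := (hχA l c).1.surjOn ha
    exact ⟨x, hx, congrArg i hxa⟩
  refine (exists_finiteCW_of_characteristicMaps cell χ ?_ ?_ ?_ ?_).elim ?_
  · rintro l (c | ⟨⟨⟨rfl⟩⟩⟩)
    · intro x hx y hy h
      exact (hχA l c).1.injOn hx hy (hi h)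
    · exact hk
  · rintro l (c | ⟨⟨⟨rfl⟩⟩⟩) l' (c' | ⟨⟨⟨rfl⟩⟩⟩) x y hx hy h
    · have h' : χA l c x = χA l' c' y := hi h
      have := FiniteCW.cell_eq_of_mem ((hχA l c).1.mapsTo hx)
        (h' ▸ (hχA l' c').1.mapsTo hy)
      cases this
      rfl
    · exact absurd h (hik _ _ hy)
    · exact absurd h.symm (hik _ _ hx)
    · rfl
  · rintro l (c | ⟨⟨⟨rfl⟩⟩⟩) x hx
    · obtain ⟨l', hl', c', hc'⟩ := FiniteCW.mem_skeletonLT.1 ((hχA l c).2 x hx)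
      obtain ⟨y, hy, h⟩ := hold hc'
      exact ⟨l', hl', Sum.inl c', y, hy, h⟩
    · let x' : DiskBoundary m := ⟨x.1, mem_sphere_zero_iff_norm.2 hx⟩
      obtain ⟨l', hl', c', hc'⟩ := FiniteCW.mem_skeletonLT.1 (hφ x')
      obtain ⟨y, hy, h⟩ := hold hc'
      exact ⟨l', hl', Sum.inl c', y, hy, h.trans (DFunLike.congr_fun hkφ x').symm⟩
  · intro q
    rcases hQ q with ⟨a, rfl⟩ | ⟨x, hx, rfl⟩
    · obtain ⟨l, c, hc⟩ := FiniteCW.exists_mem_openCell a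
      obtain ⟨x, hx, h⟩ := hold hc
      exact ⟨l, Sum.inl c, x, hx, h⟩
    · exact ⟨m, Sum.inr ⟨⟨rfl⟩⟩, x, hx, rfl⟩
  · rintro A' ⟨e, σ, hσ⟩
    have hcell : ∀ l (c : cell l), ((e : C(Q, A')).comp (χ l c)) '' {x | ‖x.1‖ < 1} =
        A'.openCell (σ l c) := fun l c => (hσ l c).1.image_eq
    let new : cell m := Sum.inr ⟨⟨rfl⟩⟩
    refine ⟨A', (e : C(Q, A')).comp i, ⟨e.injective.comp hi, fun l c => ⟨σ l (Sum.inl c), ?_⟩⟩,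
      σ m new, (e : C(Q, A')).comp k, ?_, hσ m new, ?_⟩
    · rw [← hcell, ← (hχA l c).1.image_eq, Set.image_image]
      rfl
    · rw [← hcell]
      ext q
      obtain ⟨q, rfl⟩ := e.surjective q
      constructor
      · intro hq
        rcases hQ q with ⟨a, rfl⟩ | ⟨x, hx, rfl⟩
        · exact absurd ⟨a, rfl⟩ hq
        · exact ⟨x, hx, rfl⟩
      · rintro ⟨x, hx, h⟩ ⟨a, ha⟩
        exact hik a x hx (e.injective (ha.trans h.symm))
    · rw [ContinuousMap.comp_assoc, hkφ, ContinuousMap.comp_assoc]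

/-! ### Inclusions of subcomplexes -/

lemma IsSubcomplexInclusion.id (K : FiniteCW.{u}) :
    IsSubcomplexInclusion (ContinuousMap.id K) :=
  ⟨fun _ _ h => h, fun _ c => ⟨c, Set.image_id _⟩⟩

lemma IsSubcomplexInclusion.comp {L K K' : FiniteCW.{u}} {i : C(K, K')} {j : C(L, K)}
    (hi : IsSubcomplexInclusion i) (hj : IsSubcomplexInclusion j) :
    IsSubcomplexInclusion (i.comp j) := by
  refine ⟨hi.1.comp hj.1, fun m c => ?_⟩
  obtain ⟨d, hd⟩ := hj.2 m c
  obtain ⟨e, he⟩ := hi.2 m d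
  exact ⟨e, by rw [ContinuousMap.coe_comp, Set.image_comp, hd, he]⟩

/-- A cell that meets a subcomplex is a cell of the subcomplex. -/
lemma IsSubcomplexInclusion.exists_cell {L K : FiniteCW.{u}} {i : C(L, K)}
    (hi : IsSubcomplexInclusion i) {m : ℕ} {c : K.Cell m} {x : L} (hx : i x ∈ K.openCell c) :
    ∃ d : L.Cell m, x ∈ L.openCell d ∧ i '' L.openCell d = K.openCell c := by
  obtain ⟨k, d, hd⟩ := FiniteCW.exists_mem_openCell x
  obtain ⟨e, he⟩ := hi.2 k d
  have h := FiniteCW.cell_eq_of_mem (he ▸ Set.mem_image_of_mem i hd) hx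
  cases h
  exact ⟨d, hd, he⟩

lemma IsSubcomplexInclusion.mem_skeletonLT_iff {L K : FiniteCW.{u}} {i : C(L, K)}
    (hi : IsSubcomplexInclusion i) {m : ℕ} {x : L} :
    i x ∈ K.skeletonLT m ↔ x ∈ L.skeletonLT m := by
  rw [FiniteCW.mem_skeletonLT, FiniteCW.mem_skeletonLT]
  constructor
  · rintro ⟨k, hk, c, hc⟩
    obtain ⟨d, hd, -⟩ := hi.exists_cell hc
    exact ⟨k, hk, d, hd⟩
  · rintro ⟨k, hk, d, hd⟩
    obtain ⟨c, hc⟩ := hi.2 k d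
    exact ⟨k, hk, c, hc ▸ Set.mem_image_of_mem i hd⟩

lemma IsSubcomplexInclusion.dimLE {L K : FiniteCW.{u}} {i : C(L, K)}
    (hi : IsSubcomplexInclusion i) {n : ℕ} (hK : K.DimLE n) : L.DimLE n := fun m hm =>
  ⟨fun c => (hK m hm).false (hi.2 m c).choose⟩

lemma IsCharacteristicMap.comp_inclusion {L K : FiniteCW.{u}} {i : C(L, K)} {m : ℕ}
    {c : L.Cell m} {d : K.Cell m} {ψ : C(Disk m, L)} (hψ : IsCharacteristicMap L c ψ)
    (hi : IsSubcomplexInclusion i) (hcd : i '' L.openCell c = K.openCell d) :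
    IsCharacteristicMap K d (i.comp ψ) := by
  refine ⟨?_, fun x hx => hi.mem_skeletonLT_iff.2 (hψ.2 x hx)⟩
  rw [← hcd]
  exact (hi.1.injOn.bijOn_image (s := L.openCell c)).comp hψ.1

/-! ### The universal property of a cell attachment -/

lemma exists_comp_eq_of_surjective {X Y W : Type*} [TopologicalSpace X] [TopologicalSpace Y]
    [TopologicalSpace W] [CompactSpace X] [T2Space Y] (p : C(X, Y)) (hp : Function.Surjective p)
    (f : C(X, W)) (hf : ∀ x y, p x = p y → f x = f y) : ∃ F : C(Y, W), ∀ x, F (p x) = f x := by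
  have hq : Topology.IsQuotientMap p := p.continuous.isClosedMap.isQuotientMap p.continuous hp
  exact ⟨hq.lift f fun x y h => hf x y h,
    fun x => DFunLike.congr_fun (hq.lift_comp f fun x y h => hf x y h) x⟩

/-- `A'` is obtained from `A` by attaching along `φ` the cell `c` with characteristic map `ψ`. -/
def IsAttachedBy {A A' : FiniteCW.{u}} {m : ℕ} (φ : C(DiskBoundary m, A)) (a : C(A, A'))
    (c : A'.Cell m) (ψ : C(Disk m, A')) : Prop :=
  IsSubcomplexInclusion a ∧ (Set.range a)ᶜ = A'.openCell c ∧ IsCharacteristicMap A' c ψ ∧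
    ψ.comp (boundaryIncl m) = a.comp φ

lemma IsCellAttachment.exists_isAttachedBy {A A' : FiniteCW.{u}} {m : ℕ}
    {φ : C(DiskBoundary m, A)} {a : C(A, A')} (h : IsCellAttachment φ a) :
    ∃ c ψ, IsAttachedBy φ a c ψ := by
  obtain ⟨ha, c, ψ, h⟩ := h
  exact ⟨c, ψ, ha, h⟩

lemma exists_boundary_eq {m : ℕ} {x : Disk m} (hx : ‖x.1‖ = 1) : ∃ y, boundaryIncl m y = x :=
  ⟨⟨x.1, mem_sphere_zero_iff_norm.2 hx⟩, rfl⟩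

lemma norm_boundaryIncl {m : ℕ} (x : DiskBoundary m) : ‖(boundaryIncl m x).1‖ = 1 :=
  mem_sphere_zero_iff_norm.1 x.2

namespace IsAttachedBy

variable {A A' : FiniteCW.{u}} {m : ℕ} {φ : C(DiskBoundary m, A)} {a : C(A, A')} {c : A'.Cell m}
  {ψ : C(Disk m, A')}

lemma boundary (h : IsAttachedBy φ a c ψ) (x : DiskBoundary m) :
    ψ (boundaryIncl m x) = a (φ x) :=
  DFunLike.congr_fun h.2.2.2 x

lemma mem_skeletonLT (h : IsAttachedBy φ a c ψ) (x : DiskBoundary m) : φ x ∈ A.skeletonLT m := by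
  rw [← h.1.mem_skeletonLT_iff, ← h.boundary]
  exact h.2.2.1.2 _ (norm_boundaryIncl x)

lemma cases (h : IsAttachedBy φ a c ψ) (y : A') : (∃ x, a x = y) ∨ ∃ x, ‖x.1‖ < 1 ∧ ψ x = y := by
  by_cases hy : y ∈ Set.range a
  · exact Or.inl hy
  · exact Or.inr (h.2.2.1.1.surjOn (h.2.1 ▸ hy))

lemma interior_ne (h : IsAttachedBy φ a c ψ) {x : Disk m} (hx : ‖x.1‖ < 1) (y : A) :
    ψ x ≠ a y := by
  intro hxy
  have : ψ x ∈ (Set.range a)ᶜ := h.2.1 ▸ h.2.2.1.1.mapsTo hx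
  exact this ⟨y, hxy.symm⟩

lemma injOn (h : IsAttachedBy φ a c ψ) : Set.InjOn ψ {x | ‖x.1‖ < 1} := h.2.2.1.1.injOn

lemma hom_ext (h : IsAttachedBy φ a c ψ) {Y : Type*} [TopologicalSpace Y] {F G : C(A', Y)}
    (ha : F.comp a = G.comp a) (hψ : F.comp ψ = G.comp ψ) : F = G := by
  ext y
  rcases h.cases y with ⟨x, rfl⟩ | ⟨x, -, rfl⟩
  · exact DFunLike.congr_fun ha x
  · exact DFunLike.congr_fun hψ x

/-- `A'` is the pushout of `A ← ∂D^m → D^m`. -/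
lemma exists_lift (h : IsAttachedBy φ a c ψ) {Y : Type*} [TopologicalSpace Y] (g : C(A, Y))
    (k : C(Disk m, Y)) (hk : k.comp (boundaryIncl m) = g.comp φ) :
    ∃ F : C(A', Y), F.comp a = g ∧ F.comp ψ = k := by
  have hgk : ∀ (x : A) (y : Disk m), a x = ψ y → g x = k y := by
    intro x y hxy
    rcases Disk.norm_lt_or_eq y with hy | hy
    · exact absurd hxy.symm (h.interior_ne hy x)
    · obtain ⟨y, rfl⟩ := exists_boundary_eq hy
      rw [h.boundary] at hxy
      rw [h.1.1 hxy]
      exact (DFunLike.congr_fun hk y).symm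
  obtain ⟨F, hF⟩ := exists_comp_eq_of_surjective
    (X := A ⊕ Disk m) ⟨Sum.elim a ψ, a.continuous.sumElim ψ.continuous⟩
    (fun y => by
      rcases h.cases y with ⟨x, hx⟩ | ⟨x, -, hx⟩
      · exact ⟨Sum.inl x, hx⟩
      · exact ⟨Sum.inr x, hx⟩)
    ⟨Sum.elim g k, g.continuous.sumElim k.continuous⟩
    (by
      rintro (x | x) (y | y) hxy
      · exact congrArg g (h.1.1 hxy)
      · exact hgk x y hxy
      · exact (hgk y x hxy.symm).symm
      · -- Two points of the disk: at most one of them is an interior point, unless they agree.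
        rcases Disk.norm_lt_or_eq x with hx | hx
        · rcases Disk.norm_lt_or_eq y with hy | hy
          · exact congrArg k (h.injOn hx hy hxy)
          · obtain ⟨y, rfl⟩ := exists_boundary_eq hy
            exact absurd (Eq.trans hxy (h.boundary y)) (h.interior_ne hx _)
        · obtain ⟨x, rfl⟩ := exists_boundary_eq hx
          exact (DFunLike.congr_fun hk x).trans (hgk _ y ((h.boundary x).symm.trans hxy)))
  exact ⟨F, ContinuousMap.ext fun x => hF (Sum.inl x), ContinuousMap.ext fun x => hF (Sum.inr x)⟩

/-- The cells of `A ∪ e` are the cells of `A` and `e`. -/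
lemma cell_cases (h : IsAttachedBy φ a c ψ) {k : ℕ} (d : A'.Cell k) :
    (∃ e : A.Cell k, a '' A.openCell e = A'.openCell d) ∨
      (⟨k, d⟩ : Σ l, A'.Cell l) = ⟨m, c⟩ := by
  obtain ⟨y, hy⟩ := A'.openCell_nonempty d
  rcases h.cases y with ⟨x, rfl⟩ | ⟨x, hx, rfl⟩
  · obtain ⟨e, -, he⟩ := h.1.exists_cell hy
    exact Or.inl ⟨e, he⟩
  · exact Or.inr (FiniteCW.cell_eq_of_mem hy (h.2.2.1.1.mapsTo hx))

lemma dimLE (h : IsAttachedBy φ a c ψ) {n : ℕ} (hA : A.DimLE n) (hm : m ≤ n) : A'.DimLE n := by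
  intro k hk
  refine ⟨fun d => ?_⟩
  rcases h.cell_cases d with ⟨e, -⟩ | hd
  · exact (hA k hk).false e
  · have := congrArg Sigma.fst hd
    dsimp at this
    omega

/-- Attaching a cell to a subcomplex and to the whole complex gives a subcomplex again. -/
lemma exists_inclusion {L K L' K' : FiniteCW.{u}} {j : C(L, K)} (hj : IsSubcomplexInclusion j)
    {φ : C(DiskBoundary m, L)} {b : C(L, L')} {c : L'.Cell m} {ψ : C(Disk m, L')}
    (hb : IsAttachedBy φ b c ψ)
    {b' : C(K, K')} {c' : K'.Cell m} {ψ' : C(Disk m, K')} (hb' : IsAttachedBy (j.comp φ) b' c' ψ') :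
    ∃ j' : C(L', K'), IsSubcomplexInclusion j' ∧ j'.comp b = b'.comp j ∧ j'.comp ψ = ψ' ∧
      (Set.range j')ᶜ = b' '' (Set.range j)ᶜ := by
  obtain ⟨F, hFb, hFψ⟩ := hb.exists_lift (b'.comp j) ψ' hb'.2.2.2
  have hFb' : ∀ x, F (b x) = b' (j x) := DFunLike.congr_fun hFb
  have hFψ' : ∀ x, F (ψ x) = ψ' x := DFunLike.congr_fun hFψ
  refine ⟨F, ⟨?_, fun k d => ?_⟩, hFb, hFψ, ?_⟩
  · intro x y hxy
    rcases hb.cases x with ⟨x, rfl⟩ | ⟨x, hx, rfl⟩ <;>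
      rcases hb.cases y with ⟨y, rfl⟩ | ⟨y, hy, rfl⟩
    · rw [hFb', hFb'] at hxy
      exact congrArg b (hj.1 (hb'.1.1 hxy))
    · rw [hFb', hFψ'] at hxy
      exact absurd hxy.symm (hb'.interior_ne hy _)
    · rw [hFb', hFψ'] at hxy
      exact absurd hxy (hb'.interior_ne hx _)
    · rw [hFψ', hFψ'] at hxy
      exact congrArg ψ (hb'.injOn hx hy hxy)
  · rcases hb.cell_cases d with ⟨e, he⟩ | hd
    · obtain ⟨e', he'⟩ := (hb'.1.comp hj).2 k e
      refine ⟨e', ?_⟩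
      rw [← he, ← he', ← hFb, ContinuousMap.coe_comp, Set.image_comp]
    · cases hd
      refine ⟨c', ?_⟩
      rw [← hb.2.2.1.1.image_eq, ← hb'.2.2.1.1.image_eq, ← hFψ, ContinuousMap.coe_comp,
        Set.image_comp]
  · ext y
    constructor
    · intro hy
      rcases hb'.cases y with ⟨x, rfl⟩ | ⟨x, hx, rfl⟩
      · refine ⟨x, ?_, rfl⟩
        rintro ⟨z, rfl⟩
        exact hy ⟨b z, hFb' z⟩
      · exact absurd ⟨ψ x, hFψ' x⟩ hy
    · rintro ⟨x, hx, rfl⟩ ⟨y, hy⟩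
      rcases hb.cases y with ⟨z, rfl⟩ | ⟨z, hz, rfl⟩
      · exact hx ⟨z, hb'.1.1 ((hFb' z).symm.trans hy)⟩
      · exact hb'.interior_ne hz x ((hFψ' z).symm.trans hy)

end IsAttachedBy

lemma IsCellAttachment.mem_skeletonLT {A A' : FiniteCW.{u}} {m : ℕ} {φ : C(DiskBoundary m, A)}
    {a : C(A, A')} (h : IsCellAttachment φ a) (x : DiskBoundary m) : φ x ∈ A.skeletonLT m := by
  obtain ⟨c, ψ, h⟩ := h.exists_isAttachedBy
  exact h.mem_skeletonLT x

lemma IsCellAttachment.dimLE {A A' : FiniteCW.{u}} {m : ℕ} {φ : C(DiskBoundary m, A)}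
    {a : C(A, A')} (h : IsCellAttachment φ a) {n : ℕ} (hA : A.DimLE n) (hm : m ≤ n) :
    A'.DimLE n := by
  obtain ⟨c, ψ, h⟩ := h.exists_isAttachedBy
  exact h.dimLE hA hm

lemma IsCellAttachment.le_of_dimLE {A A' : FiniteCW.{u}} {m : ℕ} {φ : C(DiskBoundary m, A)}
    {a : C(A, A')} (h : IsCellAttachment φ a) {n : ℕ} (hA : A'.DimLE n) : m ≤ n := by
  obtain ⟨c, ψ, h⟩ := h.exists_isAttachedBy
  by_contra hm
  exact (hA m (not_le.1 hm)).false c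

/-! ### Attaching a cell before and after a collapse -/

namespace IsCellularIso

variable {L K : FiniteCW.{u}} {j : C(L, K)} {r : C(K, L)}

lemma refl (K : FiniteCW.{u}) : IsCellularIso (ContinuousMap.id K) (ContinuousMap.id K) :=
  ⟨.id K, .id K, rfl, rfl⟩

lemma symm (h : IsCellularIso j r) : IsCellularIso r j := ⟨h.2.1, h.1, h.2.2.2, h.2.2.1⟩

lemma attach (h : IsCellularIso j r) {m : ℕ} {φ : C(DiskBoundary m, L)} {L' K' : FiniteCW.{u}}
    {b : C(L, L')} {b' : C(K, K')} (hb : IsCellAttachment φ b)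
    (hb' : IsCellAttachment (j.comp φ) b') :
    ∃ (j' : C(L', K')) (r' : C(K', L')),
      IsCellularIso j' r' ∧ j'.comp b = b'.comp j ∧ r'.comp b' = b.comp r := by
  obtain ⟨c, ψ, hb⟩ := hb.exists_isAttachedBy
  obtain ⟨c', ψ', hb'⟩ := hb'.exists_isAttachedBy
  obtain ⟨hj, hr, hrj, hjr⟩ := h
  obtain ⟨j', hj', hjb, hjψ, -⟩ := IsAttachedBy.exists_inclusion hj hb hb'
  have hφ : r.comp (j.comp φ) = φ := by rw [← ContinuousMap.comp_assoc, hrj, ContinuousMap.id_comp]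
  obtain ⟨r', hr', hrb, hrψ, -⟩ := IsAttachedBy.exists_inclusion (φ := j.comp φ) hr hb'
    (hφ.symm ▸ hb)
  refine ⟨j', r', ⟨hj', hr', hb.hom_ext ?_ ?_, hb'.hom_ext ?_ ?_⟩, hjb, hrb⟩
  · rw [ContinuousMap.comp_assoc, hjb, ← ContinuousMap.comp_assoc, hrb, ContinuousMap.comp_assoc,
      hrj, ContinuousMap.comp_id, ContinuousMap.id_comp]
  · rw [ContinuousMap.comp_assoc, hjψ, hrψ, ContinuousMap.id_comp]
  · rw [ContinuousMap.comp_assoc, hrb, ← ContinuousMap.comp_assoc, hjb, ContinuousMap.comp_assoc,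
      hjr, ContinuousMap.comp_id, ContinuousMap.id_comp]
  · rw [ContinuousMap.comp_assoc, hrψ, hjψ, ContinuousMap.id_comp]

end IsCellularIso

namespace IsElementaryCollapse

variable {L K : FiniteCW.{u}} {j : C(L, K)} {r : C(K, L)}

lemma retraction_mem_skeletonLT (h : IsElementaryCollapse j r) {m : ℕ} {x : K}
    (hx : x ∈ K.skeletonLT m) : r x ∈ L.skeletonLT m := by
  obtain ⟨hj, k, c₀, c₁, ψ, hc, hψ₁, hψ₀, hbox, hrj, ρ, hρ, -, hjr⟩ := h
  obtain ⟨l, hl, d, hd⟩ := FiniteCW.mem_skeletonLT.1 hx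
  by_cases hxj : x ∈ Set.range j
  · obtain ⟨y, rfl⟩ := hxj
    rw [show r (j y) = y from DFunLike.congr_fun hrj y]
    exact hj.mem_skeletonLT_iff.1 hx
  · -- Both cells outside `L` are pushed into the skeleton of the dimension of the lower one.
    have key : k + 1 ≤ m ∧ ∃ z, ψ z = x := by
      rcases (hc ▸ hxj : x ∈ K.openCell c₀ ∪ K.openCell c₁) with h | h
      · have := FiniteCW.dim_eq_of_mem hd h
        obtain ⟨z, -, hz⟩ := hψ₀.1.surjOn h
        exact ⟨by omega, topFace k z, hz⟩
      · have := FiniteCW.dim_eq_of_mem hd h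
        obtain ⟨z, -, hz⟩ := hψ₁.1.surjOn h
        exact ⟨by omega, z, hz⟩
    obtain ⟨hkm, z, rfl⟩ := key
    obtain ⟨y, hy, hyz⟩ := hbox (ρ z) (hρ z)
    rw [hj.1 ((hjr z).trans hyz.symm)]
    exact L.skeletonLT_mono hkm hy

lemma attach (h : IsElementaryCollapse j r) {m : ℕ} {φ : C(DiskBoundary m, L)}
    {L' K' : FiniteCW.{u}} {b : C(L, L')} {b' : C(K, K')} (hb : IsCellAttachment φ b)
    (hb' : IsCellAttachment (j.comp φ) b') :
    ∃ (j' : C(L', K')) (r' : C(K', L')),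
      IsElementaryCollapse j' r' ∧ j'.comp b = b'.comp j ∧ r'.comp b' = b.comp r := by
  obtain ⟨c, ψ, hb⟩ := hb.exists_isAttachedBy
  obtain ⟨c', ψ', hb'⟩ := hb'.exists_isAttachedBy
  obtain ⟨hj, k, c₀, c₁, χ, hc, hχ₁, hχ₀, hbox, hrj, ρ, hρ, hρbox, hjr⟩ := h
  obtain ⟨j', hj', hjb, hjψ, hjc⟩ := IsAttachedBy.exists_inclusion hj hb hb'
  obtain ⟨r', hrb, hrψ⟩ := hb'.exists_lift (b.comp r) ψ (by
    rw [hb.2.2.2, ContinuousMap.comp_assoc, ← ContinuousMap.comp_assoc r, hrj,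
      ContinuousMap.id_comp])
  have hjb' : ∀ x, j' (b x) = b' (j x) := DFunLike.congr_fun hjb
  have hjψ' : ∀ x, j' (ψ x) = ψ' x := DFunLike.congr_fun hjψ
  have hrb' : ∀ x, r' (b' x) = b (r x) := DFunLike.congr_fun hrb
  obtain ⟨d₀, hd₀⟩ := hb'.1.2 _ c₀
  obtain ⟨d₁, hd₁⟩ := hb'.1.2 _ c₁
  refine ⟨j', r', ⟨hj', k, d₀, d₁, b'.comp χ, ?_, hχ₁.comp_inclusion hb'.1 hd₁,
    hχ₀.comp_inclusion hb'.1 hd₀, ?_, hb.hom_ext ?_ ?_, ρ, hρ, hρbox, ?_⟩, hjb, hrb⟩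
  · rw [← hd₀, ← hd₁, ← Set.image_union, ← hc, hjc]
  · intro x hx
    obtain ⟨y, hy, hyx⟩ := hbox x hx
    exact ⟨b y, hb.1.mem_skeletonLT_iff.2 hy, (hjb' y).trans (congrArg b' hyx)⟩
  · rw [ContinuousMap.comp_assoc, hjb, ← ContinuousMap.comp_assoc, hrb, ContinuousMap.comp_assoc,
      hrj, ContinuousMap.comp_id, ContinuousMap.id_comp]
  · rw [ContinuousMap.comp_assoc, hjψ, hrψ, ContinuousMap.id_comp]
  · intro x
    change j' (r' (b' (χ x))) = b' (χ (ρ x))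
    rw [hrb', hjb', hjr]

end IsElementaryCollapse

namespace IsCollapse

lemma isSubcomplexInclusion {L K : FiniteCW.{u}} {j : C(L, K)} {r : C(K, L)}
    (h : IsCollapse j r) : IsSubcomplexInclusion j := by
  induction h with
  | iso h => exact h.1
  | step h _ ih => exact h.1.comp ih

lemma retraction_mem_skeletonLT {L K : FiniteCW.{u}} {j : C(L, K)} {r : C(K, L)}
    (h : IsCollapse j r) {m : ℕ} {x : K} (hx : x ∈ K.skeletonLT m) : r x ∈ L.skeletonLT m := by
  induction h with
  | iso h => exact h.2.1.mem_skeletonLT_iff.2 hx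
  | step h _ ih => exact ih (h.retraction_mem_skeletonLT hx)

/-- Collapses are stable under attaching a cell to the smaller complex. -/
theorem attach {L K : FiniteCW.{u}} {j : C(L, K)} {r : C(K, L)} (h : IsCollapse j r) {m : ℕ}
    {φ : C(DiskBoundary m, L)} {L' K' : FiniteCW.{u}} {b : C(L, L')} {b' : C(K, K')}
    (hb : IsCellAttachment φ b) (hb' : IsCellAttachment (j.comp φ) b') :
    ∃ (j' : C(L', K')) (r' : C(K', L')),
      IsCollapse j' r' ∧ j'.comp b = b'.comp j ∧ r'.comp b' = b.comp r := by
  induction h generalizing K' with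
  | iso h =>
    obtain ⟨j', r', h', h₁, h₂⟩ := h.attach hb hb'
    exact ⟨j', r', .iso h', h₁, h₂⟩
  | @step K₁ K j r j₁ r₁ h h₁ ih =>
    obtain ⟨K₁', b₁, hb₁⟩ := exists_isCellAttachment (j₁.comp φ) fun x =>
      h₁.isSubcomplexInclusion.mem_skeletonLT_iff.2 (hb.mem_skeletonLT x)
    obtain ⟨j₁', r₁', h₁', hjb₁, hrb₁⟩ := ih hb₁
    obtain ⟨j', r', h', hjb, hrb⟩ := h.attach hb₁ hb'
    refine ⟨j'.comp j₁', r₁'.comp r', .step h' h₁', ?_, ?_⟩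
    · rw [ContinuousMap.comp_assoc, hjb₁, ← ContinuousMap.comp_assoc, hjb,
        ContinuousMap.comp_assoc]
    · rw [ContinuousMap.comp_assoc, hrb, ← ContinuousMap.comp_assoc, hrb₁,
        ContinuousMap.comp_assoc]

end IsCollapse

/-! ### The disk `D^(m+1)` as a cylinder over `D^m` -/

lemma norm_snoc {m : ℕ} (x : Fin m → ℝ) (t : ℝ) :
    ‖(Fin.snoc (α := fun _ => ℝ) x t : Fin (m + 1) → ℝ)‖ = max ‖x‖ |t| := by
  apply le_antisymm
  · refine (pi_norm_le_iff_of_nonneg (le_max_of_le_left (norm_nonneg x))).2 fun k => ?_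
    refine Fin.lastCases ?_ (fun k => ?_) k
    · simp
    · simpa using Or.inl (norm_le_pi_norm x k)
  · refine max_le ((pi_norm_le_iff_of_nonneg (norm_nonneg _)).2 fun k => ?_) ?_
    · simpa using norm_le_pi_norm (Fin.snoc (α := fun _ => ℝ) x t : Fin (m + 1) → ℝ) k.castSucc
    · simpa using norm_le_pi_norm (Fin.snoc (α := fun _ => ℝ) x t : Fin (m + 1) → ℝ) (Fin.last m)

/-- The identification of `D^m × [0, 1]` with `D^(m+1)`; the bottom of the cylinder goes to the
bottom face and the top to the top face. -/
noncomputable def cylinder (m : ℕ) : Disk m × unitInterval ≃ₜ Disk (m + 1) :=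
  Continuous.homeoOfEquivCompactToT2
    (f :=
      { toFun := fun p => ⟨Fin.snoc (α := fun _ => ℝ) p.1.1 (2 * (p.2 : ℝ) - 1), by
          have h0 := p.2.2.1
          have h1 := p.2.2.2
          rw [mem_closedBall_zero_iff, norm_snoc]
          exact max_le (Disk.norm_le p.1) (abs_le.2 ⟨by linarith, by linarith⟩)⟩
        invFun := fun x =>
          ⟨⟨Fin.init x.1, mem_closedBall_zero_iff.2 <|
            (pi_norm_le_iff_of_nonneg zero_le_one).2 fun k =>
              (norm_le_pi_norm x.1 k.castSucc).trans (Disk.norm_le x)⟩,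
            ⟨(x.1 (Fin.last m) + 1) / 2, by
              have := abs_le.1 ((norm_le_pi_norm x.1 (Fin.last m)).trans (Disk.norm_le x))
              constructor <;> linarith [this.1, this.2]⟩⟩
        left_inv := fun p => by
          ext1
          · exact Subtype.ext (Fin.init_snoc (α := fun _ => ℝ) _ _)
          · apply Subtype.ext
            simp
        right_inv := fun x => by
          apply Subtype.ext
          have h : 2 * ((x.1 (Fin.last m) + 1) / 2) - 1 = x.1 (Fin.last m) := by ring
          simp only [h]
          exact Fin.snoc_init_self (α := fun _ => ℝ) x.1 })
    (Continuous.subtype_mk (Continuous.finSnoc (A := fun _ => ℝ)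
      (continuous_subtype_val.comp continuous_fst) (by fun_prop)) _)

lemma cylinder_val {m : ℕ} (x : Disk m) (t : unitInterval) :
    (cylinder m (x, t)).1 = Fin.snoc (α := fun _ => ℝ) x.1 (2 * (t : ℝ) - 1) := rfl

lemma norm_cylinder {m : ℕ} (x : Disk m) (t : unitInterval) :
    ‖(cylinder m (x, t)).1‖ = max ‖x.1‖ |2 * (t : ℝ) - 1| := by
  rw [cylinder_val, norm_snoc]

lemma cylinder_one {m : ℕ} (x : Disk m) : cylinder m (x, 1) = topFace m x := by
  apply Subtype.ext
  change Fin.snoc (α := fun _ => ℝ) x.1 (2 * (1 : ℝ) - 1) = Fin.snoc (α := fun _ => ℝ) x.1 1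
  norm_num

lemma unitInterval_abs_eq_one {t : unitInterval} (h : |2 * (t : ℝ) - 1| = 1) : t = 0 ∨ t = 1 := by
  rcases (abs_eq zero_le_one).1 h with h | h
  · exact Or.inr (Subtype.ext (by rw [Set.Icc.coe_one]; linarith))
  · exact Or.inl (Subtype.ext (by rw [Set.Icc.coe_zero]; linarith))

lemma cylinder_mem_openBox {m : ℕ} {x : Disk m} {t : unitInterval} :
    cylinder m (x, t) ∈ openBox m ↔ t = 0 ∨ ‖x.1‖ = 1 := by
  refine or_congr ?_ ?_
  · rw [cylinder_val, Fin.snoc_last, Subtype.ext_iff, Set.Icc.coe_zero]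
    constructor <;> intro h <;> linarith
  · simp only [cylinder_val, Fin.snoc_castSucc]
    constructor
    · rintro ⟨k, hk⟩
      exact le_antisymm (Disk.norm_le x) (hk.symm.le.trans (norm_le_pi_norm x.1 k))
    · intro h
      by_contra! hne
      refine h.not_lt ((pi_norm_lt_iff zero_lt_one).2 fun k => lt_of_le_of_ne ?_ (hne k))
      exact (norm_le_pi_norm x.1 k).trans h.le

lemma norm_of_mem_openBox {m : ℕ} {x : Disk (m + 1)} (hx : x ∈ openBox m) : ‖x.1‖ = 1 := by
  obtain ⟨⟨x, t⟩, rfl⟩ := (cylinder m).surjective x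
  refine le_antisymm (Disk.norm_le _) ?_
  rw [norm_cylinder]
  rcases cylinder_mem_openBox.1 hx with rfl | h
  · simp
  · exact h.symm.le.trans (le_max_left _ _)

lemma norm_topFace {m : ℕ} (x : Disk m) : ‖(topFace m x).1‖ = 1 := by
  refine le_antisymm (Disk.norm_le _) ?_
  rw [← cylinder_one, norm_cylinder, Set.Icc.coe_one]
  refine le_max_of_le_right ?_
  norm_num

/-- The disk is the disjoint union of its interior, the open top face and the open box. -/
lemma disk_cases {m : ℕ} (x : Disk (m + 1)) :
    ‖x.1‖ < 1 ∨ x ∈ openBox m ∨ ∃ y : Disk m, ‖y.1‖ < 1 ∧ topFace m y = x := by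
  obtain ⟨⟨x, t⟩, rfl⟩ := (cylinder m).surjective x
  rcases Disk.norm_lt_or_eq (cylinder m (x, t)) with h | h
  · exact Or.inl h
  rcases Disk.norm_lt_or_eq x with hx | hx
  · rw [norm_cylinder] at h
    have ht : |2 * (t : ℝ) - 1| = 1 := by
      rcases max_choice ‖x.1‖ |2 * (t : ℝ) - 1| with h' | h'
      · exact absurd (h'.symm.trans h) hx.ne
      · exact h'.symm.trans h
    rcases unitInterval_abs_eq_one ht with rfl | rfl
    · exact Or.inr (Or.inl (cylinder_mem_openBox.2 (Or.inl rfl)))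
    · exact Or.inr (Or.inr ⟨x, hx, (cylinder_one x).symm⟩)
  · exact Or.inr (Or.inl (cylinder_mem_openBox.2 (Or.inr hx)))

/-- The disk retracts onto the open box. -/
lemma exists_openBox_retraction (m : ℕ) : ∃ ρ : C(Disk (m + 1), Disk (m + 1)),
    (∀ x, ρ x ∈ openBox m) ∧ ∀ x ∈ openBox m, ρ x = x := by
  -- Radial projection from the point at height `2` on the axis of `D^m × [-1, 1]`. In cylinder
  -- coordinates it divides the horizontal part and the distance to that height by `M`.
  let M : Disk m × unitInterval → ℝ := fun p => max ‖p.1.1‖ (1 - 2 * (p.2 : ℝ) / 3)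
  have hMc : Continuous M := by fun_prop
  have hM0 : ∀ p, 1 / 3 ≤ M p := fun p =>
    le_max_of_le_right (by linarith [p.2.2.2])
  have hMpos : ∀ p, 0 < M p := fun p => lt_of_lt_of_le (by norm_num) (hM0 p)
  have hM1 : ∀ p, M p ≤ 1 := fun p => max_le (Disk.norm_le p.1) (by linarith [p.2.2.1])
  let R : Disk m × unitInterval → Disk m × unitInterval := fun p =>
    (⟨(M p)⁻¹ • p.1.1, by
      rw [mem_closedBall_zero_iff, norm_smul, norm_inv, Real.norm_of_nonneg (hMpos p).le,
        inv_mul_le_iff₀ (hMpos p), mul_one]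
      exact le_max_left _ _⟩,
     ⟨3 / 2 * (1 - (M p)⁻¹ * (1 - 2 * (p.2 : ℝ) / 3)), by
      have h1 : (M p)⁻¹ * (1 - 2 * (p.2 : ℝ) / 3) ≤ 1 := by
        rw [inv_mul_le_iff₀ (hMpos p), mul_one]
        exact le_max_right _ _
      have h2 : 1 / 3 ≤ (M p)⁻¹ * (1 - 2 * (p.2 : ℝ) / 3) := by
        rw [le_inv_mul_iff₀ (hMpos p)]
        linarith [hM1 p, p.2.2.2]
      constructor <;> linarith⟩)
  have hMinv : Continuous fun p => (M p)⁻¹ := hMc.inv₀ fun p => (hMpos p).ne'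
  have hR : Continuous R := by
    refine Continuous.prodMk (Continuous.subtype_mk ?_ _) (Continuous.subtype_mk ?_ _)
    · exact hMinv.smul (continuous_subtype_val.comp continuous_fst)
    · fun_prop
  have hRbox : ∀ p, (R p).2 = 0 ∨ ‖(R p).1.1‖ = 1 := by
    intro p
    rcases max_choice ‖p.1.1‖ (1 - 2 * (p.2 : ℝ) / 3) with h | h
    · right
      have h : M p = ‖p.1.1‖ := h
      change ‖(M p)⁻¹ • p.1.1‖ = 1
      rw [norm_smul, norm_inv, Real.norm_of_nonneg (hMpos p).le, ← h,
        inv_mul_cancel₀ (hMpos p).ne']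
    · left
      have h : M p = 1 - 2 * (p.2 : ℝ) / 3 := h
      apply Subtype.ext
      change 3 / 2 * (1 - (M p)⁻¹ * (1 - 2 * (p.2 : ℝ) / 3)) = 0
      rw [← h, inv_mul_cancel₀ (hMpos p).ne']
      ring
  have hRid : ∀ p : Disk m × unitInterval, p.2 = 0 ∨ ‖p.1.1‖ = 1 → R p = p := by
    intro p hp
    have hM : M p = 1 := by
      refine le_antisymm (hM1 p) ?_
      rcases hp with h | h
      · refine le_max_of_le_right ?_
        rw [h, Set.Icc.coe_zero]
        norm_num
      · exact h ▸ le_max_left _ _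
    ext1
    · apply Subtype.ext
      change (M p)⁻¹ • p.1.1 = p.1.1
      rw [hM, inv_one, one_smul]
    · apply Subtype.ext
      change 3 / 2 * (1 - (M p)⁻¹ * (1 - 2 * (p.2 : ℝ) / 3)) = p.2
      rw [hM]
      ring
  refine ⟨⟨fun x => cylinder m (R ((cylinder m).symm x)), by fun_prop⟩, fun x => ?_,
    fun x hx => ?_⟩
  · exact cylinder_mem_openBox.2 (hRbox _)
  · obtain ⟨p, rfl⟩ := (cylinder m).surjective x
    change cylinder m (R ((cylinder m).symm (cylinder m p))) = _
    rw [Homeomorph.symm_apply_apply, hRid p (cylinder_mem_openBox.1 hx)]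

/-- The reflection of `D^(m+1) = D^m × [-1, 1]` that exchanges the bottom and the top face. -/
noncomputable def diskFlip (m : ℕ) : C(Disk (m + 1), Disk (m + 1)) where
  toFun x := cylinder m (((cylinder m).symm x).1, unitInterval.symm ((cylinder m).symm x).2)

lemma diskFlip_cylinder {m : ℕ} (x : Disk m) (t : unitInterval) :
    diskFlip m (cylinder m (x, t)) = cylinder m (x, unitInterval.symm t) := by
  change cylinder m (((cylinder m).symm (cylinder m (x, t))).1,
    unitInterval.symm ((cylinder m).symm (cylinder m (x, t))).2) = _
  rw [Homeomorph.symm_apply_apply]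

lemma diskFlip_diskFlip {m : ℕ} (x : Disk (m + 1)) : diskFlip m (diskFlip m x) = x := by
  obtain ⟨⟨x, t⟩, rfl⟩ := (cylinder m).surjective x
  rw [diskFlip_cylinder, diskFlip_cylinder, unitInterval.symm_symm]

lemma norm_diskFlip {m : ℕ} (x : Disk (m + 1)) : ‖(diskFlip m x).1‖ = ‖x.1‖ := by
  obtain ⟨⟨x, t⟩, rfl⟩ := (cylinder m).surjective x
  rw [diskFlip_cylinder, norm_cylinder, norm_cylinder, unitInterval.coe_symm_eq,
    ← abs_neg (2 * (t : ℝ) - 1)]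
  ring_nf

lemma IsCharacteristicMap.comp_diskFlip {K : FiniteCW.{u}} {m : ℕ} {c : K.Cell (m + 1)}
    {ψ : C(Disk (m + 1), K)} (h : IsCharacteristicMap K c ψ) :
    IsCharacteristicMap K c (ψ.comp (diskFlip m)) := by
  refine ⟨h.1.comp ⟨fun x hx => ?_, fun x _ y _ hxy => ?_, fun x hx => ?_⟩, fun x hx => ?_⟩
  · exact (norm_diskFlip x).trans_lt hx
  · rw [← diskFlip_diskFlip x, hxy, diskFlip_diskFlip]
  · exact ⟨diskFlip m x, (norm_diskFlip x).trans_lt hx, diskFlip_diskFlip x⟩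
  · exact h.2 _ ((norm_diskFlip x).trans hx)

lemma IsCharacteristicMap.mem_skeletonLT_succ {K : FiniteCW.{u}} {m : ℕ} {c : K.Cell m}
    {ψ : C(Disk m, K)} (h : IsCharacteristicMap K c ψ) (x : Disk m) :
    ψ x ∈ K.skeletonLT (m + 1) := by
  rcases Disk.norm_lt_or_eq x with hx | hx
  · exact FiniteCW.mem_skeletonLT.2 ⟨m, m.lt_succ_self, c, h.1.mapsTo hx⟩
  · exact K.skeletonLT_mono m.le_succ (h.2 x hx)

/-! ### Elementary collapses and their deformations -/

/-- The part of an elementary collapse of `K` to `L` that does not involve the retraction: `K`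
consists of `L` and the cells `c₀`, `c₁`, and the characteristic map `ψ` of `c₁` restricts to one of
`c₀` on the top face. -/
def IsCollapsePair {L K : FiniteCW.{u}} (j : C(L, K)) {m : ℕ} (c₀ : K.Cell m)
    (c₁ : K.Cell (m + 1)) (ψ : C(Disk (m + 1), K)) : Prop :=
  IsSubcomplexInclusion j ∧
    (Set.range j)ᶜ = K.openCell c₀ ∪ K.openCell c₁ ∧
    IsCharacteristicMap K c₁ ψ ∧
    IsCharacteristicMap K c₀ (ψ.comp (topFace m)) ∧
    ∀ x ∈ openBox m, ψ x ∈ j '' L.skeletonLT (m + 1)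

namespace IsCollapsePair

variable {L K : FiniteCW.{u}} {j : C(L, K)} {m : ℕ} {c₀ : K.Cell m} {c₁ : K.Cell (m + 1)}
  {ψ : C(Disk (m + 1), K)}

lemma cases (h : IsCollapsePair j c₀ c₁ ψ) (y : K) : (∃ x, j x = y) ∨ ∃ x, ψ x = y := by
  by_cases hy : y ∈ Set.range j
  · exact Or.inl hy
  · rcases (h.2.1 ▸ hy : y ∈ K.openCell c₀ ∪ K.openCell c₁) with hy | hy
    · obtain ⟨x, -, hx⟩ := h.2.2.2.1.1.surjOn hy
      exact Or.inr ⟨topFace m x, hx⟩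
    · obtain ⟨x, -, hx⟩ := h.2.2.1.1.surjOn hy
      exact Or.inr ⟨x, hx⟩

lemma mem_openBox_of_eq (h : IsCollapsePair j c₀ c₁ ψ) {x : Disk (m + 1)} {y : L}
    (hxy : ψ x = j y) : x ∈ openBox m := by
  have hy : ψ x ∉ (Set.range j)ᶜ := fun hx => hx ⟨y, hxy.symm⟩
  rw [h.2.1] at hy
  rcases disk_cases x with hx | hx | ⟨x, hx, rfl⟩
  · exact absurd (Or.inr (h.2.2.1.1.mapsTo hx)) hy
  · exact hx
  · exact absurd (Or.inl (h.2.2.2.1.1.mapsTo hx)) hy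

lemma eq_or_mem_openBox (h : IsCollapsePair j c₀ c₁ ψ) {x y : Disk (m + 1)} (hxy : ψ x = ψ y) :
    x = y ∨ x ∈ openBox m ∧ y ∈ openBox m := by
  -- A point of the open box is sent to `L`, and a point that is sent to `L` is in the open box.
  have hbox : ∀ {x y : Disk (m + 1)}, ψ x = ψ y → x ∈ openBox m → y ∈ openBox m := by
    intro x y hxy hx
    obtain ⟨z, -, hz⟩ := h.2.2.2.2 x hx
    exact h.mem_openBox_of_eq (hxy.symm.trans hz.symm)
  have hcell : ∀ {x : Disk (m + 1)} {y : Disk m}, ‖x.1‖ < 1 → ‖y.1‖ < 1 → ψ x ≠ ψ (topFace m y) :=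
    fun {x y} hx hy he => by
      have h₀ : ψ x ∈ K.openCell c₀ := he ▸ h.2.2.2.1.1.mapsTo hy
      exact absurd (FiniteCW.dim_eq_of_mem (h.2.2.1.1.mapsTo hx) h₀) (by omega)
  rcases disk_cases x with hx | hx | ⟨x, hx, rfl⟩
  · rcases disk_cases y with hy | hy | ⟨y, hy, rfl⟩
    · exact Or.inl (h.2.2.1.1.injOn hx hy hxy)
    · exact Or.inr ⟨hbox hxy.symm hy, hy⟩
    · exact absurd hxy (hcell hx hy)
  · exact Or.inr ⟨hx, hbox hxy hx⟩
  · rcases disk_cases y with hy | hy | ⟨y, hy, rfl⟩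
    · exact absurd hxy.symm (hcell hy hx)
    · exact Or.inr ⟨hbox hxy.symm hy, hy⟩
    · exact Or.inl (congrArg (topFace m) (h.2.2.2.1.1.injOn hx hy hxy))

/-- `K × T` is glued from `L × T` and `D^(m+1) × T` along the open box, for compact `T`. -/
lemma exists_lift (h : IsCollapsePair j c₀ c₁ ψ) {T Y : Type*} [TopologicalSpace T]
    [CompactSpace T] [T2Space T] [TopologicalSpace Y] (g : C(L × T, Y)) (k : C(Disk (m + 1) × T, Y))
    (hk : ∀ x ∈ openBox m, ∀ y t, ψ x = j y → k (x, t) = g (y, t)) :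
    ∃ F : C(K × T, Y), (∀ y t, F (j y, t) = g (y, t)) ∧ ∀ x t, F (ψ x, t) = k (x, t) := by
  let p : C((L × T) ⊕ (Disk (m + 1) × T), K × T) :=
    ⟨Sum.elim (fun q => (j q.1, q.2)) (fun q => (ψ q.1, q.2)), by
      refine Continuous.sumElim ?_ ?_ <;> fun_prop⟩
  have hp : Function.Surjective p := by
    rintro ⟨y, t⟩
    rcases h.cases y with ⟨x, rfl⟩ | ⟨x, rfl⟩
    · exact ⟨Sum.inl (x, t), rfl⟩
    · exact ⟨Sum.inr (x, t), rfl⟩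
  obtain ⟨F, hF⟩ := exists_comp_eq_of_surjective p hp
    ⟨Sum.elim g k, g.continuous.sumElim k.continuous⟩ (by
      rintro (⟨x, t⟩ | ⟨x, t⟩) (⟨y, s⟩ | ⟨y, s⟩) hxy <;> obtain ⟨hxy, rfl⟩ := Prod.ext_iff.1 hxy
      · obtain rfl := h.1.1 hxy
        rfl
      · exact (hk y (h.mem_openBox_of_eq hxy.symm) x t hxy.symm).symm
      · exact hk x (h.mem_openBox_of_eq hxy) y t hxy
      · rcases h.eq_or_mem_openBox hxy with rfl | ⟨hx, hy⟩
        · rfl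
        · obtain ⟨z, -, hz⟩ := h.2.2.2.2 x hx
          exact (hk x hx z t hz.symm).trans (hk y hy z t (hxy.symm.trans hz.symm)).symm)
  exact ⟨F, fun y t => hF (Sum.inl (y, t)), fun x t => hF (Sum.inr (x, t))⟩

lemma exists_isElementaryCollapse (h : IsCollapsePair j c₀ c₁ ψ) :
    ∃ r : C(K, L), IsElementaryCollapse j r := by
  obtain ⟨ρ, hρ, hρbox⟩ := exists_openBox_retraction m
  have hj : Topology.IsEmbedding j := (j.continuous.isClosedEmbedding h.1.1).isEmbedding
  have hmem : ∀ x, ∃ y, j y = ψ (ρ x) := fun x => by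
    obtain ⟨y, -, hy⟩ := h.2.2.2.2 _ (hρ x)
    exact ⟨y, hy⟩
  choose k hk using hmem
  have hkc : Continuous k := hj.continuous_iff.2 <| by
    have : j ∘ k = ψ ∘ ρ := funext hk
    rw [this]
    fun_prop
  obtain ⟨F, hFj, hFψ⟩ := h.exists_lift (T := Unit) ⟨fun p => p.1, by fun_prop⟩
    ⟨fun p => k p.1, by fun_prop⟩ (fun x hx y _ hxy => h.1.1 (by
      change j (k x) = j y
      rw [hk, hρbox x hx, hxy]))
  refine ⟨⟨fun x => F (x, ()), by fun_prop⟩, h.1, m, c₀, c₁, ψ, h.2.1, h.2.2.1, h.2.2.2.1,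
    h.2.2.2.2, ?_, ρ, hρ, hρbox, fun x => ?_⟩
  · ext y : 1
    exact hFj y ()
  · exact (congrArg j (hFψ x ())).trans (hk x)

end IsCollapsePair

/-- Two maps `f`, `g` to a complex are homotopic through maps to the union of its cells of
dimension `≤ m`. -/
def HomotopicInSkeleton {X : Type*} [TopologicalSpace X] {K : FiniteCW.{u}} (m : ℕ)
    (f g : C(X, K)) : Prop :=
  f.HomotopicWith g fun h => ∀ x, h x ∈ K.skeletonLT (m + 1)

lemma HomotopicInSkeleton.comp_inclusion {X : Type*} [TopologicalSpace X] {L K : FiniteCW.{u}}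
    {m : ℕ} {f g : C(X, L)} (h : HomotopicInSkeleton m f g) {i : C(L, K)}
    (hi : IsSubcomplexInclusion i) : HomotopicInSkeleton m (i.comp f) (i.comp g) := by
  obtain ⟨H⟩ := h
  exact ⟨{  toHomotopy := (ContinuousMap.Homotopy.refl i).comp H.toHomotopy
            prop' := fun t x => hi.mem_skeletonLT_iff.2 (H.prop' t x) }⟩

/-- The retraction of an elementary collapse is homotopic to the identity by a homotopy that raises
the dimension of the skeleta by at most one: it moves the points of the upper cell inside it. -/
lemma IsElementaryCollapse.homotopicInSkeleton {L K : FiniteCW.{u}} {j : C(L, K)} {r : C(K, L)}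
    (h : IsElementaryCollapse j r) {X : Type*} [TopologicalSpace X] {m : ℕ} {f : C(X, K)}
    (hf : ∀ x, f x ∈ K.skeletonLT m) : HomotopicInSkeleton m f (j.comp (r.comp f)) := by
  obtain ⟨hj, k, c₀, c₁, ψ, hc, hψ₁, hψ₀, hbox, hrj, ρ, hρ, hρbox, hjr⟩ := h
  have hp : IsCollapsePair j c₀ c₁ ψ := ⟨hj, hc, hψ₁, hψ₀, hbox⟩
  let ℓ : C(Disk (k + 1) × unitInterval, Disk (k + 1)) :=
    ⟨fun p => ⟨AffineMap.lineMap p.1.1 (ρ p.1).1 (p.2 : ℝ),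
      (convex_closedBall (0 : Fin (k + 1) → ℝ) 1).lineMap_mem p.1.2 (ρ p.1).2 p.2.2⟩, by
      refine Continuous.subtype_mk ?_ _
      simp only [AffineMap.lineMap_apply_module]
      fun_prop⟩
  have hℓ0 : ∀ x, ℓ (x, 0) = x := fun x => Subtype.ext (AffineMap.lineMap_apply_zero _ _)
  have hℓ1 : ∀ x, ℓ (x, 1) = ρ x := fun x => Subtype.ext (AffineMap.lineMap_apply_one _ _)
  obtain ⟨F, hFj, hFψ⟩ := hp.exists_lift (T := unitInterval) ⟨fun p => j p.1, by fun_prop⟩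
    (ψ.comp ℓ) (by
      intro x hx y t hxy
      have : ℓ (x, t) = x := by
        apply Subtype.ext
        change AffineMap.lineMap x.1 (ρ x).1 (t : ℝ) = x.1
        rw [hρbox x hx, AffineMap.lineMap_same_apply]
      change ψ (ℓ (x, t)) = j y
      rw [this, hxy])
  have hF0 : ∀ y, F (y, 0) = y := by
    intro y
    rcases hp.cases y with ⟨x, rfl⟩ | ⟨x, rfl⟩
    · exact hFj x 0
    · exact (hFψ x 0).trans (congrArg ψ (hℓ0 x))
  have hF1 : ∀ y, F (y, 1) = j (r y) := by
    intro y
    rcases hp.cases y with ⟨x, rfl⟩ | ⟨x, rfl⟩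
    · rw [show r (j x) = x from DFunLike.congr_fun hrj x]
      exact hFj x 1
    · rw [hjr, ← hℓ1]
      exact hFψ x 1
  have hFs : ∀ y t, y ∈ K.skeletonLT m → F (y, t) ∈ K.skeletonLT (m + 1) := by
    intro y t hy
    by_cases hyj : y ∈ Set.range j
    · obtain ⟨x, rfl⟩ := hyj
      rw [hFj]
      exact K.skeletonLT_mono m.le_succ hy
    · obtain ⟨l, hl, d, hd⟩ := FiniteCW.mem_skeletonLT.1 hy
      have hkm : k + 2 ≤ m + 1 := by
        rcases (hc ▸ hyj : y ∈ K.openCell c₀ ∪ K.openCell c₁) with h | h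
        · have := FiniteCW.dim_eq_of_mem hd h
          omega
        · have := FiniteCW.dim_eq_of_mem hd h
          omega
      obtain ⟨x, rfl⟩ := (hp.cases y).resolve_left fun ⟨x, hx⟩ => hyj ⟨x, hx⟩
      rw [hFψ]
      exact K.skeletonLT_mono hkm (hψ₁.mem_skeletonLT_succ _)
  exact ⟨{  toFun := fun p => F (f p.2, p.1)
            continuous_toFun := by fun_prop
            map_zero_left := fun x => hF0 (f x)
            map_one_left := fun x => hF1 (f x)
            prop' := fun t x => hFs (f x) t (hf x) }⟩

lemma IsCollapse.homotopicInSkeleton {L K : FiniteCW.{u}} {j : C(L, K)} {r : C(K, L)}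
    (h : IsCollapse j r) {X : Type*} [TopologicalSpace X] {m : ℕ} {f : C(X, K)}
    (hf : ∀ x, f x ∈ K.skeletonLT m) : HomotopicInSkeleton m f (j.comp (r.comp f)) := by
  induction h with
  | iso h =>
    rw [← ContinuousMap.comp_assoc, h.2.2.2, ContinuousMap.id_comp]
    exact .refl f fun x => FiniteCW.skeletonLT_mono _ m.le_succ (hf x)
  | step h _ ih =>
    exact (h.homotopicInSkeleton hf).trans
      ((ih fun x => h.retraction_mem_skeletonLT (hf x)).comp_inclusion h.1)

/-! ### Sliding a cell along a homotopy of its attaching map -/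

/-- The boundary of the cylinder consists of its bottom, its top and its side. -/
lemma boundary_cylinder_cases {m : ℕ} {z : Disk (m + 1)} (hz : ‖z.1‖ = 1) :
    (∃ x, cylinder m (x, 0) = z) ∨ (∃ x, cylinder m (x, 1) = z) ∨
      ∃ x t, cylinder m (boundaryIncl m x, t) = z := by
  rcases disk_cases z with h | h | ⟨x, -, hx⟩
  · exact absurd hz h.ne
  · obtain ⟨⟨x, t⟩, rfl⟩ := (cylinder m).surjective z
    rcases cylinder_mem_openBox.1 h with rfl | h
    · exact Or.inl ⟨x, rfl⟩
    · obtain ⟨x, rfl⟩ := exists_boundary_eq h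
      exact Or.inr (Or.inr ⟨x, t, rfl⟩)
  · exact Or.inr (Or.inl ⟨x, (cylinder_one x).trans hx⟩)

/-- Maps on the bottom, the top and the side of the cylinder that agree on the edges are glued to a
map on its boundary. -/
lemma exists_map_cylinder_boundary {m : ℕ} {Y : Type*} [TopologicalSpace Y] (f₀ f₁ : C(Disk m, Y))
    (H : C(unitInterval × DiskBoundary m, Y)) (h₀ : ∀ x, H (0, x) = f₀ (boundaryIncl m x))
    (h₁ : ∀ x, H (1, x) = f₁ (boundaryIncl m x)) :
    ∃ Φ : C(DiskBoundary (m + 1), Y), ∀ z,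
      (∀ x, cylinder m (x, 0) = boundaryIncl (m + 1) z → Φ z = f₀ x) ∧
      (∀ x, cylinder m (x, 1) = boundaryIncl (m + 1) z → Φ z = f₁ x) ∧
      ∀ x t, cylinder m (boundaryIncl m x, t) = boundaryIncl (m + 1) z → Φ z = H (t, x) := by
  have hbot : ∀ x, ‖(cylinder m (x, 0)).1‖ = 1 := fun x =>
    norm_of_mem_openBox (cylinder_mem_openBox.2 (Or.inl rfl))
  have htop : ∀ x, ‖(cylinder m (x, 1)).1‖ = 1 := fun x => cylinder_one x ▸ norm_topFace x
  have hside : ∀ p : unitInterval × DiskBoundary m,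
      ‖(cylinder m (boundaryIncl m p.2, p.1)).1‖ = 1 := fun p =>
    norm_of_mem_openBox (cylinder_mem_openBox.2 (Or.inr (norm_boundaryIncl p.2)))
  let q : (Disk m ⊕ Disk m) ⊕ (unitInterval × DiskBoundary m) → Disk m × unitInterval :=
    Sum.elim (Sum.elim (fun x => (x, 0)) (fun x => (x, 1))) (fun p => (boundaryIncl m p.2, p.1))
  have hq : Continuous q :=
    Continuous.sumElim (Continuous.sumElim (by fun_prop) (by fun_prop)) (by fun_prop)
  have hq1 : ∀ s, ‖(cylinder m (q s)).1‖ = 1 := by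
    rintro ((x | x) | p)
    · exact hbot x
    · exact htop x
    · exact hside p
  let p : C((Disk m ⊕ Disk m) ⊕ (unitInterval × DiskBoundary m), DiskBoundary (m + 1)) :=
    ⟨fun s => ⟨(cylinder m (q s)).1, mem_sphere_zero_iff_norm.2 (hq1 s)⟩, by fun_prop⟩
  have hpq : ∀ s, boundaryIncl (m + 1) (p s) = cylinder m (q s) := fun _ => rfl
  have hinj : Function.Injective (boundaryIncl (m + 1)) :=
    Set.inclusion_injective Metric.sphere_subset_closedBall
  have hinj' : Function.Injective (boundaryIncl m) :=
    Set.inclusion_injective Metric.sphere_subset_closedBall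
  have hp : Function.Surjective p := by
    intro z
    rcases boundary_cylinder_cases (norm_boundaryIncl z) with ⟨x, hx⟩ | ⟨x, hx⟩ | ⟨x, t, hx⟩
    · exact ⟨Sum.inl (Sum.inl x), hinj hx⟩
    · exact ⟨Sum.inl (Sum.inr x), hinj hx⟩
    · exact ⟨Sum.inr (t, x), hinj hx⟩
  let f : C((Disk m ⊕ Disk m) ⊕ (unitInterval × DiskBoundary m), Y) :=
    ⟨Sum.elim (Sum.elim f₀ f₁) H,
      (f₀.continuous.sumElim f₁.continuous).sumElim H.continuous⟩
  have hf : ∀ s s', p s = p s' → f s = f s' := by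
    intro s s' h
    have h : q s = q s' := (cylinder m).injective (congrArg (boundaryIncl (m + 1)) h)
    rcases s with (x | x) | ⟨t, x⟩ <;> rcases s' with (y | y) | ⟨s, y⟩ <;>
      obtain ⟨hx, ht⟩ := Prod.ext_iff.1 h <;> dsimp [q] at hx ht
    · exact congrArg f₀ hx
    · exact absurd ht zero_ne_one
    · subst hx ht
      exact (h₀ y).symm
    · exact absurd ht one_ne_zero
    · exact congrArg f₁ hx
    · subst hx ht
      exact (h₁ y).symm
    · subst hx ht
      exact h₀ x
    · subst hx ht
      exact h₁ x
    · obtain rfl := hinj' hx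
      subst ht
      rfl
  obtain ⟨Φ, hΦ⟩ := exists_comp_eq_of_surjective p hp f hf
  refine ⟨Φ, fun z => ⟨fun x hx => ?_, fun x hx => ?_, fun x t hx => ?_⟩⟩
  · obtain rfl : p (Sum.inl (Sum.inl x)) = z := hinj hx
    exact hΦ _
  · obtain rfl : p (Sum.inl (Sum.inr x)) = z := hinj hx
    exact hΦ _
  · obtain rfl : p (Sum.inr (t, x)) = z := hinj hx
    exact hΦ _

/-- If the attaching maps of two `m`-cells are homotopic in the `m`-skeleton, then the complexes
`A ∪ e₀` and `A ∪ e₁` have a common elementary expansion: an `(m+1)`-cell is attached to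
`A ∪ e₀ ∪ e₁` along the boundary of the cylinder `D^m × [-1, 1]`, by the characteristic maps on the
bottom and the top and by the homotopy on the side. Either of `e₀`, `e₁` is a free face. -/
theorem exists_common_elementary_expansion {A A₀ A₁ : FiniteCW.{u}} {m : ℕ}
    {φ₀ φ₁ : C(DiskBoundary m, A)} {a₀ : C(A, A₀)} {a₁ : C(A, A₁)} (h₀ : IsCellAttachment φ₀ a₀)
    (h₁ : IsCellAttachment φ₁ a₁) (h : HomotopicInSkeleton m φ₀ φ₁) :
    ∃ (Z : FiniteCW.{u}) (i₀ : C(A₀, Z)) (r₀ : C(Z, A₀)) (i₁ : C(A₁, Z)) (r₁ : C(Z, A₁)),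
      IsElementaryCollapse i₀ r₀ ∧ IsElementaryCollapse i₁ r₁ ∧ i₀.comp a₀ = i₁.comp a₁ ∧
      ∀ k, A.DimLE k → m + 1 ≤ k → Z.DimLE k := by
  obtain ⟨c₀, ψ₀, h₀⟩ := h₀.exists_isAttachedBy
  obtain ⟨c₁, ψ₁, h₁⟩ := h₁.exists_isAttachedBy
  obtain ⟨H⟩ := h
  obtain ⟨B, b, hb⟩ := exists_isCellAttachment (a₀.comp φ₁) fun x =>
    h₀.1.mem_skeletonLT_iff.2 (h₁.mem_skeletonLT x)
  obtain ⟨d₁, χ₁, hb⟩ := hb.exists_isAttachedBy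
  obtain ⟨b', hb', hba, hbψ, hbc⟩ := IsAttachedBy.exists_inclusion h₀.1 h₁ hb
  have hba' : ∀ x, b' (a₁ x) = b (a₀ x) := DFunLike.congr_fun hba
  have hbψ' : ∀ x, b' (ψ₁ x) = χ₁ x := DFunLike.congr_fun hbψ
  obtain ⟨Φ, hΦ⟩ := exists_map_cylinder_boundary (b.comp ψ₀) χ₁
    ((b.comp a₀).comp H.toHomotopy.toContinuousMap)
    (fun x => by
      change b (a₀ (H (0, x))) = b (ψ₀ _)
      rw [H.apply_zero, h₀.boundary])
    (fun x => by
      change b (a₀ (H (1, x))) = χ₁ _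
      rw [H.apply_one, hb.boundary]
      rfl)
  have hside : ∀ z x t, cylinder m (boundaryIncl m x, t) = boundaryIncl (m + 1) z →
      Φ z = b (a₀ (H (t, x))) := fun z => (hΦ z).2.2
  have hH : ∀ t x, H (t, x) ∈ A.skeletonLT (m + 1) := fun t x => H.prop' t x
  obtain ⟨Z, z, hz⟩ := exists_isCellAttachment Φ (fun y => by
    rcases boundary_cylinder_cases (norm_boundaryIncl y) with ⟨x, hx⟩ | ⟨x, hx⟩ | ⟨x, t, hx⟩
    · rw [(hΦ y).1 x hx]
      exact hb.1.mem_skeletonLT_iff.2 (h₀.2.2.1.mem_skeletonLT_succ x)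
    · rw [(hΦ y).2.1 x hx]
      exact hb.2.2.1.mem_skeletonLT_succ x
    · rw [hside y x t hx]
      exact (hb.1.comp h₀.1).mem_skeletonLT_iff.2 (hH t x))
  obtain ⟨d, χ, hz⟩ := hz.exists_isAttachedBy
  have hχbot : ∀ x, χ (cylinder m (x, 0)) = z (b (ψ₀ x)) := by
    intro x
    obtain ⟨y, hy⟩ := exists_boundary_eq
      (norm_of_mem_openBox ((cylinder_mem_openBox (x := x) (t := 0)).2 (Or.inl rfl)))
    rw [← hy, hz.boundary, (hΦ y).1 x hy.symm]
    rfl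
  have hχtop : ∀ x, χ (cylinder m (x, 1)) = z (χ₁ x) := by
    intro x
    obtain ⟨y, hy⟩ := exists_boundary_eq (cylinder_one x ▸ norm_topFace x)
    rw [← hy, hz.boundary, (hΦ y).2.1 x hy.symm]
  have hχside : ∀ x t, χ (cylinder m (boundaryIncl m x, t)) = z (b (a₀ (H (t, x)))) := by
    intro x t
    obtain ⟨y, hy⟩ := exists_boundary_eq
      (norm_of_mem_openBox (cylinder_mem_openBox.2 (Or.inr (norm_boundaryIncl x) : t = 0 ∨ _)))
    rw [← hy, hz.boundary, hside y x t hy.symm]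
  have hcompl : ∀ {A' : FiniteCW.{u}} (i : C(A', B)),
      (Set.range (z.comp i))ᶜ = z '' (Set.range i)ᶜ ∪ Z.openCell d := by
    intro A' i
    ext y
    constructor
    · intro hy
      by_cases hyz : y ∈ Set.range z
      · obtain ⟨x, rfl⟩ := hyz
        refine Or.inl ⟨x, ?_, rfl⟩
        rintro ⟨w, rfl⟩
        exact hy ⟨w, rfl⟩
      · exact Or.inr (hz.2.1 ▸ hyz)
    · rintro (⟨x, hx, rfl⟩ | hy) ⟨w, hw⟩
      · exact hx ⟨w, hz.1.1 hw⟩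
      · rw [← hz.2.1] at hy
        exact hy ⟨i w, hw⟩
  obtain ⟨e₁, he₁⟩ := hz.1.2 m d₁
  obtain ⟨e₀, he₀⟩ := (hz.1.comp hb.1).2 m c₀
  have hpair₀ : IsCollapsePair (z.comp b) e₁ d χ := by
    refine ⟨hz.1.comp hb.1, ?_, hz.2.2.1, ?_, ?_⟩
    · rw [hcompl, hb.2.1, he₁]
    · have : χ.comp (topFace m) = z.comp χ₁ := by
        ext x : 1
        change χ (topFace m x) = z (χ₁ x)
        rw [← cylinder_one, hχtop]
      rw [this]
      exact hb.2.2.1.comp_inclusion hz.1 he₁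
    · intro x hx
      obtain ⟨⟨x, t⟩, rfl⟩ := (cylinder m).surjective x
      rcases cylinder_mem_openBox.1 hx with rfl | hx
      · exact ⟨ψ₀ x, h₀.2.2.1.mem_skeletonLT_succ x, (hχbot x).symm⟩
      · obtain ⟨x, rfl⟩ := exists_boundary_eq hx
        exact ⟨a₀ (H (t, x)), h₀.1.mem_skeletonLT_iff.2 (hH t x), (hχside x t).symm⟩
  have hpair₁ : IsCollapsePair (z.comp b') e₀ d (χ.comp (diskFlip m)) := by
    refine ⟨hz.1.comp hb', ?_, hz.2.2.1.comp_diskFlip, ?_, ?_⟩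
    · rw [hcompl, hbc, h₀.2.1, ← he₀, ContinuousMap.coe_comp, Set.image_comp]
    · have : (χ.comp (diskFlip m)).comp (topFace m) = (z.comp b).comp ψ₀ := by
        ext x : 1
        change χ (diskFlip m (topFace m x)) = z (b (ψ₀ x))
        rw [← cylinder_one, diskFlip_cylinder, unitInterval.symm_one, hχbot]
      rw [this]
      exact h₀.2.2.1.comp_inclusion (hz.1.comp hb.1) he₀
    · intro x hx
      obtain ⟨⟨x, t⟩, rfl⟩ := (cylinder m).surjective x
      rw [ContinuousMap.comp_apply, diskFlip_cylinder]
      rcases cylinder_mem_openBox.1 hx with rfl | hx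
      · refine ⟨ψ₁ x, h₁.2.2.1.mem_skeletonLT_succ x, ?_⟩
        rw [unitInterval.symm_zero, hχtop, ContinuousMap.comp_apply, hbψ']
      · obtain ⟨x, rfl⟩ := exists_boundary_eq hx
        refine ⟨a₁ (H (unitInterval.symm t, x)), h₁.1.mem_skeletonLT_iff.2 (hH _ x), ?_⟩
        rw [hχside, ContinuousMap.comp_apply, hba']
  obtain ⟨r₀, hr₀⟩ := hpair₀.exists_isElementaryCollapse
  obtain ⟨r₁, hr₁⟩ := hpair₁.exists_isElementaryCollapse
  refine ⟨Z, z.comp b, r₀, z.comp b', r₁, hr₀, hr₁, ?_, fun k hA hk => ?_⟩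
  · rw [ContinuousMap.comp_assoc, ContinuousMap.comp_assoc, hba]
  · exact hz.dimLE (hb.dimLE (h₀.dimLE hA (by omega)) (by omega)) hk

/-! ### Internal collapses -/

lemma IsElementaryCollapse.retraction_comp {L K : FiniteCW.{u}} {j : C(L, K)} {r : C(K, L)}
    (h : IsElementaryCollapse j r) : r.comp j = ContinuousMap.id L := by
  obtain ⟨-, _, _, _, _, -, -, -, -, h, -⟩ := h
  exact h

/-- One step of an internal collapse: a cell attached to a complex `A` that expands to `Z`, while
`Z` collapses to `B`, is slid along the collapse until it is attached to `B`. -/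
lemma exists_internalCollapse_step {A Z B A' : FiniteCW.{u}} {ι : C(A, Z)} {s : C(Z, A)}
    (hι : IsCollapse ι s) {j : C(B, Z)} {r : C(Z, B)} (hr : IsCollapse j r) {m : ℕ}
    {φ : C(DiskBoundary m, A)} {a : C(A, A')} (ha : IsCellAttachment φ a) {k : ℕ}
    (hZ : Z.DimLE k) (hm : m + 1 ≤ k) :
    ∃ (Z' B' : FiniteCW.{u}) (b : C(B, B')) (z : C(Z, Z')) (ι' : C(A', Z')) (s' : C(Z', A'))
      (j' : C(B', Z')) (r' : C(Z', B')),
      IsCellAttachment (r.comp (ι.comp φ)) b ∧ IsSubcomplexInclusion z ∧ Z'.DimLE k ∧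
      IsCollapse ι' s' ∧ IsCollapse j' r' ∧
      ι'.comp a = z.comp ι ∧ j'.comp b = z.comp j ∧ r'.comp z = b.comp r := by
  have hιφ : ∀ x, ι.comp φ x ∈ Z.skeletonLT m := fun x =>
    hι.isSubcomplexInclusion.mem_skeletonLT_iff.2 (ha.mem_skeletonLT x)
  have hrφ : ∀ x, r.comp (ι.comp φ) x ∈ B.skeletonLT m := fun x =>
    hr.retraction_mem_skeletonLT (hιφ x)
  obtain ⟨B', b, hb⟩ := exists_isCellAttachment _ hrφ
  obtain ⟨Z₀, z₀, hz₀⟩ := exists_isCellAttachment _ hιφ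
  obtain ⟨Z₁, z₁, hz₁⟩ := exists_isCellAttachment (j.comp (r.comp (ι.comp φ))) fun x =>
    hr.isSubcomplexInclusion.mem_skeletonLT_iff.2 (hrφ x)
  obtain ⟨ι₀, s₀, hι₀, hιz, -⟩ := hι.attach ha hz₀
  obtain ⟨j₁, r₁, hj₁, hjz, hrz⟩ := hr.attach hb hz₁
  obtain ⟨Z', i₀, t₀, i₁, t₁, hi₀, hi₁, hi, hdim⟩ :=
    exists_common_elementary_expansion hz₀ hz₁ (hr.homotopicInSkeleton hιφ)
  refine ⟨Z', B', b, i₁.comp z₁, i₀.comp ι₀, s₀.comp t₀, i₁.comp j₁, r₁.comp t₁, hb,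
    hi₁.1.comp hz₁.1, hdim k hZ hm, .step hi₀ hι₀, .step hi₁ hj₁, ?_, ?_, ?_⟩
  · rw [ContinuousMap.comp_assoc, hιz, ← ContinuousMap.comp_assoc, hi]
  · rw [ContinuousMap.comp_assoc, hjz, ContinuousMap.comp_assoc]
  · rw [ContinuousMap.comp_assoc, ← ContinuousMap.comp_assoc t₁, hi₁.retraction_comp,
      ContinuousMap.id_comp, hrz]

namespace IsInternalCollapse

variable {n : ℕ} {K L : FiniteCW.{u}} {j₀ : C(L, K)} {r₀ : C(K, L)} {A Z B : FiniteCW.{u}}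
  {T : CellTower K A} {U : CellTower L B} {ι : C(A, Z)} {j : C(B, Z)} {r : C(Z, B)}

lemma exists_expansion (h : IsInternalCollapse n j₀ r₀ T U ι j r) : ∃ s, IsCollapse ι s := by
  cases h with
  | base h => exact ⟨_, .iso (.refl K)⟩
  | attach _ _ _ _ _ hι => exact ⟨_, hι⟩

lemma isCollapse (h : IsInternalCollapse n j₀ r₀ T U ι j r) : IsCollapse j r := by
  cases h with
  | base h => exact h
  | attach _ _ _ _ _ _ hr => exact hr

lemma dimLE (h : IsInternalCollapse n j₀ r₀ T U ι j r) (hA : A.DimLE n) : Z.DimLE (n + 1) := by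
  cases h with
  | base h => exact hA.mono n.le_succ
  | attach _ _ _ _ hdim => exact hdim

/-- The cells of the two towers have the same dimensions. -/
lemma dimLE_target (h : IsInternalCollapse n j₀ r₀ T U ι j r) (hA : A.DimLE n) : B.DimLE n := by
  induction h with
  | base h => exact h.isSubcomplexInclusion.dimLE hA
  | attach _ ha hb _ _ _ _ _ _ _ ih => exact hb.dimLE (ih (ha.1.dimLE hA)) (ha.le_of_dimLE hA)

end IsInternalCollapse

theorem exists_isInternalCollapse {n : ℕ} {K L : FiniteCW.{u}} {j₀ : C(L, K)} {r₀ : C(K, L)}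
    (h : IsCollapse j₀ r₀) {A : FiniteCW.{u}} (T : CellTower K A) (hA : A.DimLE n) :
    ∃ (B Z : FiniteCW.{u}) (U : CellTower L B) (ι : C(A, Z)) (j : C(B, Z)) (r : C(Z, B)),
      IsInternalCollapse n j₀ r₀ T U ι j r := by
  induction T with
  | nil => exact ⟨L, K, .nil, _, _, _, .base h⟩
  | attach T φ a ha ih =>
    have hA' := ha.1.dimLE hA
    obtain ⟨B, Z, U, ι, j, r, hT⟩ := ih hA'
    obtain ⟨s, hs⟩ := hT.exists_expansion
    obtain ⟨Z', B', b, z, ι', s', j', r', hb, hz, hdim, hι, hr, h₁, h₂, h₃⟩ :=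
      exists_internalCollapse_step hs hT.isCollapse ha (hT.dimLE hA')
        (Nat.succ_le_succ (ha.le_of_dimLE hA))
    exact ⟨B', Z', U.attach _ b hb, ι', j', r', hT.attach ha hb hz hdim hι hr h₁ h₂ h₃⟩

/-! ### Deformations and attached cells -/

lemma IsCollapse.isDeformation {L K : FiniteCW.{u}} {j : C(L, K)} {r : C(K, L)}
    (h : IsCollapse j r) {k : ℕ} (hK : K.DimLE k) :
    IsDeformation k j ∧ IsDeformation k r := by
  induction h with
  | iso h => exact ⟨.iso h (h.1.dimLE hK), .iso h.symm hK⟩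
  | step h _ ih =>
    obtain ⟨h₁, h₂⟩ := ih (h.1.dimLE hK)
    exact ⟨.comp h₁ (.expand h hK), .comp (.collapse h hK) h₂⟩

namespace IsDeformation

variable {k : ℕ} {A M : FiniteCW.{u}} {g : C(A, M)}

lemma mem_skeletonLT (h : IsDeformation k g) {m : ℕ} {x : A} (hx : x ∈ A.skeletonLT m) :
    g x ∈ M.skeletonLT m := by
  induction h with
  | iso h _ => exact h.1.mem_skeletonLT_iff.2 hx
  | expand h _ => exact h.1.mem_skeletonLT_iff.2 hx
  | collapse h _ => exact h.retraction_mem_skeletonLT hx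
  | comp _ _ ih ih' => exact ih' (ih hx)

/-- A deformation extends over a cell of low dimension that is attached to the source along `φ` and
to the target along the image of `φ`. The case to consider is the retraction `r` of an elementary
collapse with inclusion `j`: the cell is first slid from `φ` to `j ∘ r ∘ φ`. -/
theorem exists_extension (h : IsDeformation k g) {m : ℕ} (hm : m + 1 ≤ k)
    {φ : C(DiskBoundary m, A)} {A' M' : FiniteCW.{u}} {b : C(A, A')} {c : C(M, M')}
    (hb : IsCellAttachment φ b) (hc : IsCellAttachment (g.comp φ) c) :
    ∃ g' : C(A', M'), IsDeformation k g' ∧ g'.comp b = c.comp g := by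
  induction h generalizing A' M' with
  | iso h hdim =>
    obtain ⟨g', r', h', h₁, -⟩ := h.attach hb hc
    exact ⟨g', .iso h' (hb.dimLE hdim (by omega)), h₁⟩
  | expand h hdim =>
    obtain ⟨g', r', h', h₁, -⟩ := h.attach hb hc
    exact ⟨g', .expand h' (hc.dimLE hdim (by omega)), h₁⟩
  | @collapse K L j r h hdim =>
    have hφ := hb.mem_skeletonLT
    obtain ⟨A₁, a₁, ha₁⟩ := exists_isCellAttachment (j.comp (r.comp φ)) fun x =>
      h.1.mem_skeletonLT_iff.2 (hc.mem_skeletonLT x)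
    obtain ⟨Z, i₀, r₀, i₁, r₁, h₀, h₁, hi, hZ⟩ :=
      exists_common_elementary_expansion hb ha₁ (h.homotopicInSkeleton hφ)
    obtain ⟨j', r', h', -, hrc⟩ := h.attach hc ha₁
    have hZk : Z.DimLE k := hZ k hdim hm
    refine ⟨r'.comp (r₁.comp i₀), .comp (.comp (.expand h₀ hZk) (.collapse h₁ hZk))
      (.collapse h' (h₁.1.dimLE hZk)), ?_⟩
    rw [ContinuousMap.comp_assoc, ContinuousMap.comp_assoc, hi, ← ContinuousMap.comp_assoc r₁,
      h₁.retraction_comp, ContinuousMap.id_comp, hrc]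
  | @comp K K₁ L f g hf hg ihf ihg =>
    obtain ⟨K₁', b₁, hb₁⟩ := exists_isCellAttachment (f.comp φ) fun x =>
      hf.mem_skeletonLT (hb.mem_skeletonLT x)
    obtain ⟨f', hf', hfb⟩ := ihf hb hb₁
    obtain ⟨g', hg', hgb⟩ := ihg hb₁ hc
    refine ⟨g'.comp f', .comp hf' hg', ?_⟩
    rw [ContinuousMap.comp_assoc, hfb, ← ContinuousMap.comp_assoc, hgb, ContinuousMap.comp_assoc]

end IsDeformation

lemma IsInternalCollapse.isDeformation {n : ℕ} {K L : FiniteCW.{u}} {j₀ : C(L, K)} {r₀ : C(K, L)}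
    {A Z B : FiniteCW.{u}} {T : CellTower K A} {U : CellTower L B} {ι : C(A, Z)} {j : C(B, Z)}
    {r : C(Z, B)} (h : IsInternalCollapse n j₀ r₀ T U ι j r) (hA : A.DimLE n) :
    IsDeformation (n + 1) (r.comp ι) := by
  obtain ⟨s, hs⟩ := h.exists_expansion
  exact .comp (hs.isDeformation (h.dimLE hA)).1 (h.isCollapse.isDeformation (h.dimLE hA)).2

lemma IsInducedAttachment.isDeformation {k : ℕ} {A M₀ M : FiniteCW.{u}} {W : CellTower M₀ M}
    {g : C(A, M)} {B M' : FiniteCW.{u}} {U : CellTower A B} {V : CellTower M₀ M'} {f : C(B, M')}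
    (h : IsInducedAttachment k W g U V f) : IsDeformation k f := by
  cases h with
  | base hg => exact hg
  | attach _ _ _ hf _ => exact hf

theorem exists_isInducedAttachment {k : ℕ} {A M₀ M : FiniteCW.{u}} (W : CellTower M₀ M)
    {g : C(A, M)} (hg : IsDeformation (k + 1) g) {B : FiniteCW.{u}} (U : CellTower A B)
    (hB : B.DimLE k) :
    ∃ (M' : FiniteCW.{u}) (V : CellTower M₀ M') (f : C(B, M')),
      IsInducedAttachment (k + 1) W g U V f := by
  induction U with
  | nil => exact ⟨M, W, g, .base hg⟩
  | attach U φ b hb ih =>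
    obtain ⟨M', V, f, hf⟩ := ih (hb.1.dimLE hB)
    obtain ⟨M'', c, hc⟩ := exists_isCellAttachment (f.comp φ) fun x =>
      hf.isDeformation.mem_skeletonLT (hb.mem_skeletonLT x)
    obtain ⟨f', hf', hfb⟩ := hf.isDeformation.exists_extension
      (Nat.succ_le_succ (hb.le_of_dimLE hB)) hb hc
    exact ⟨M'', V.attach _ c hc, f', hf.attach hb hc hf' hfb⟩

/-! ### Subcomplexes and the composition of internal collapses -/

lemma dimLE_ofSubcomplex {L : FiniteCW.{u}} {n : ℕ} (hL : L.DimLE n)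
    (E : Topology.RelCWComplex.Subcomplex L.carrier) : (L.ofSubcomplex E).DimLE n := fun m hm =>
  ⟨fun c => (hL m hm).false (c.1 : L.Cell m)⟩

lemma exists_isCellularIso_inclTop {L : FiniteCW.{u}}
    {E : Topology.RelCWComplex.Subcomplex L.carrier} (hE : (E : Set L.space) = L.carrier) :
    ∃ r : C(L, L.ofSubcomplex E), IsCellularIso (L.inclTop E) r := by
  have hi : IsSubcomplexInclusion (L.inclTop E) := by
    refine ⟨Set.inclusion_injective
      (Topology.RelCWComplex.Subcomplex.subset_complex E), fun m c => ⟨c.1, ?_⟩⟩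
    ext x
    constructor
    · rintro ⟨y, hy, rfl⟩
      exact hy
    · intro hx
      exact ⟨⟨x.1, hE.symm.subset x.2⟩, hx, rfl⟩
  let r : C(L, L.ofSubcomplex E) :=
    ContinuousMap.inclusion (s := L.carrier) (t := (E : Set L.space)) hE.symm.subset
  have hir : (L.inclTop E).comp r = ContinuousMap.id L := rfl
  have hri : r.comp (L.inclTop E) = ContinuousMap.id _ := rfl
  refine ⟨r, hi, ⟨Set.inclusion_injective hE.symm.subset, fun m c => ?_⟩, hri, hir⟩
  obtain ⟨x, hx⟩ := L.openCell_nonempty c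
  obtain ⟨d, -, hd⟩ := hi.exists_cell (x := r x) hx
  refine ⟨d, ?_⟩
  rw [← hd, ← Set.image_comp]
  exact Set.image_id _

theorem exists_isInducedReduction {k N : ℕ} {L : Fin (N + 2) → FiniteCW.{u}}
    {P : Fin (N + 1) → FiniteCW.{u}} (U : ∀ j : Fin (N + 1), CellTower (L j.castSucc) (P j))
    (q : ∀ j : Fin (N + 1), C(L j.succ, P j)) (hL : (L 0).DimLE (k + 1))
    (hP : ∀ j, (P j).DimLE k) (hq : ∀ j, IsDeformation (k + 1) (q j)) (j : Fin (N + 2)) :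
    ∃ (M : FiniteCW.{u}) (W : CellTower (L 0) M) (g : C(L j, M)),
      IsDeformation (k + 1) g ∧ IsInducedReduction (k + 1) U q j W g := by
  induction j using Fin.induction with
  | zero => exact ⟨L 0, .nil, _, .iso (.refl _) hL, .start⟩
  | succ j ih =>
    obtain ⟨M, W, g, hg, h⟩ := ih
    obtain ⟨M', V, f, hf⟩ := exists_isInducedAttachment W hg (U j) (hP j)
    exact ⟨M', V, f.comp (q j), .comp (hq j) hf.isDeformation, .step j h hf⟩

end CWDeformation

theorem mainTheorem5 (n N : ℕ) (L : FiniteCW.{u}) (hdim : L.DimLE n)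
    -- the filtration `L_0 ≤ K_0 ≤ L_1 ≤ K_1 ≤ ⋯ ≤ L_N ≤ K_N ≤ L_{N+1} = L`
    (SL : Fin (N + 2) → Topology.RelCWComplex.Subcomplex L.carrier)
    (SK : Fin (N + 1) → Topology.RelCWComplex.Subcomplex L.carrier)
    (hLK : ∀ j : Fin (N + 1), SL j.castSucc ≤ SK j)
    (hKL : ∀ j : Fin (N + 1), SK j ≤ SL j.succ)
    (htop : (SL (Fin.last (N + 1)) : Set L.space) = L.carrier)
    -- the collapses `K_j ↘ L_j`, with their retractions
    (ret : ∀ j : Fin (N + 1), C(L.ofSubcomplex (SK j), L.ofSubcomplex (SL j.castSucc)))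
    (hcollapse : ∀ j : Fin (N + 1), IsCollapse (L.inclSub (hLK j)) (ret j))
    -- the cells `L_{j+1} = K_j ∪ ⋃_i e_i^j`, with their attaching maps
    (T : ∀ j : Fin (N + 1), CellTower (L.ofSubcomplex (SK j)) (L.ofSubcomplex (SL j.succ)))
    (hT : ∀ j : Fin (N + 1), (T j).incl = L.inclSub (hKL j)) :
    -- there are internal collapses from `L_{j+1}` to `P_j = L_j ∪ ⋃_i ẽ_i^j`
    (∀ j : Fin (N + 1), ∃ (P Z : FiniteCW.{u}) (U : CellTower (L.ofSubcomplex (SL j.castSucc)) P)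
      (ι : C(L.ofSubcomplex (SL j.succ), Z)) (i : C(P, Z)) (r : C(Z, P)),
      IsInternalCollapse n (L.inclSub (hLK j)) (ret j) (T j) U ι i r) ∧
    -- and any such internal collapses induce an `(n+1)`-deformation from `L` to
    -- `M = L_0 ∪ ⋃_j ⋃_i ẽ_i^j`, with the induced attaching maps
    (∀ (P Z : Fin (N + 1) → FiniteCW.{u})
      (U : ∀ j : Fin (N + 1), CellTower (L.ofSubcomplex (SL j.castSucc)) (P j))
      (ι : ∀ j : Fin (N + 1), C(L.ofSubcomplex (SL j.succ), Z j))
      (i : ∀ j : Fin (N + 1), C(P j, Z j)) (r : ∀ j : Fin (N + 1), C(Z j, P j)),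
      (∀ j : Fin (N + 1),
        IsInternalCollapse n (L.inclSub (hLK j)) (ret j) (T j) (U j) (ι j) (i j) (r j)) →
      ∃ (M : FiniteCW.{u}) (W : CellTower (L.ofSubcomplex (SL 0)) M) (f : C(L, M)),
        IsDeformation (n + 1) f ∧
        IsInducedReduction (n + 1) (L := fun j => L.ofSubcomplex (SL j)) U
          (fun j => (r j).comp (ι j)) (Fin.last (N + 1)) W
          (f.comp (L.inclTop (SL (Fin.last (N + 1)))))) := by
  refine ⟨fun j => exists_isInternalCollapse (hcollapse j) (T j) (dimLE_ofSubcomplex hdim _), ?_⟩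
  intro P Z U ι i r h
  obtain ⟨M, W, g, hg, hred⟩ := exists_isInducedReduction (k := n)
    (L := fun j => L.ofSubcomplex (SL j)) U (fun j => (r j).comp (ι j))
    ((dimLE_ofSubcomplex hdim _).mono n.le_succ)
    (fun j => (h j).dimLE_target (dimLE_ofSubcomplex hdim _))
    (fun j => (h j).isDeformation (dimLE_ofSubcomplex hdim _)) (Fin.last (N + 1))
  obtain ⟨s, hs⟩ := exists_isCellularIso_inclTop htop
  refine ⟨M, W, g.comp s, .comp (.iso hs.symm (hdim.mono n.le_succ)) hg, ?_⟩
  rw [ContinuousMap.comp_assoc, hs.2.2.1, ContinuousMap.comp_id]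
  exact hred
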